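/- Setting. A single trial has a finite set $S$ of sites; site $s$ has finite-dimensional non-zero input and output spaces $\mathcal H^{s_I},\mathcal H^{s_O}$, and $\mathcal H=\bigotimes_{s}\mathcal H^{s_I}\otimes\mathcal H^{s_O}$. A CPTP map at $s$ is (in Choi form) an operator $M_s\ge 0$ on $\mathcal H^{s_I}\otimes\mathcal H^{s_O}$ with $\mathrm{tr}_{s_O}M_s=\mathbb 1$. A process matrix is an operator $W\ge0$ with $\mathrm{tr}[(\bigotimes_s M_s)W]=1$ for all CPTP maps $M_s$ at the sites; $\mathfrak W$ is the set of single-trial process matrices, and an $n$-trial process matrix is a process matrix on $\mathcal H^{\otimes n}$ with the $n|S|$ sites of all trials. A sequence $W^{(n)}$, $n\ge1$, of $n$-trial process matrices is exchangeable if each $W^{(n)}$ is invariant under all permutations of the $n$ trials and $W^{(n)}=\mathrm{tr}_{n+1}[W^{(n+1)}(\mathbb 1^{\otimes n}\otimes M)]$ for every $n\ge 1$ and every $M=\bigotimes_s M_s$ with $M_s$ CPTP. For disjoint sets of sites $K_1,K_2$ in a trial, no signalling from $K_2$ to $K_1$ means that the reduced operator $\mathrm{tr}_{S\setminus K_1}[(\mathbb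 1^{K_1}\otimes\bigotimes_{s\notin K_1}M_s)W]$ does not depend on the CPTP maps $M_s$, $s\in K_2$, whatever the CPTP maps at the remaining sites are; this is a linear constraint $L^{K_1\prec K_2}(W)=0$. A comb (causally ordered process) for a total order of the sites is a process matrix with no signalling from $\{s: s\ge t\}$ to $\{s:s<t\}$ for every site $t$. A linear function $L$ is imposed in trial $j$ of $W^{(n)}$ by requiring $(\mathcal I\otimes\cdots\otimes L\otimes\cdots\otimes\mathcal I)(W^{(n)})=0$ with $L$ in position $j$ (a real linear function on self-adjoint operators being extended complex linearly). Statement. Let $(W^{(n)})_{n\ge1}$ be an exchangeable sequence of process matrices and let $N\ge2$. 1. Let $V^k$ be real vector spaces and $L^k$ real linear functions from the self-adjoint operators on $\mathcal H$ to $V^k$, for $k$ in any index set. If $W^{(N)}$ satisfies the constraint $L^k$ in trial $j$ for all $k$ and all $j=1,\dots,N$, then there is a unique Borel probability measure $P$ on $\mathfrak W$ with $$W^{(n)}=\int_{\mathfrak W} W^{\otimes n}\,dP(W)\qquad\text{for all } n\ge1,$$ and $P$ is supported on $\{W\in\mathfrak W: L^k(W)=0\ \forall k\}$. 2. In particular,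 this holds for any family of no-signalling constraints $L^{K_1\prec K_2}$: if they are satisfied in each trial of $W^{(N)}$, then the unique $P$ is supported on the single-trial process matrices that satisfy the same no-signalling constraints. 3. In particular, for a total order of the sites of a trial, if the comb constraints are satisfied in each trial of $W^{(N)}$, then the unique $P$ is supported on combs for this order. The same conclusion holds if $W^{(N)}$ itself is a comb for some total order of all $N|S|$ sites that restricts to the given order in each trial. -/

import Mathlib

open MeasureTheory
open scoped ComplexOrder

noncomputable section

namespace ProcessDeFinetti

/-- The Borel structure on a space of matrices (for the entrywise topology). -/
instance matrixMeasurableSpace {m n : Type*} : MeasurableSpace (Matrix m n ℂ) := borel _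

instance matrixBorelSpace {m n : Type*} : BorelSpace (Matrix m n ℂ) := ⟨rfl⟩

section Sites

/-! A scenario has a finite set `S` of sites. Site `s` has an input space with orthonormal basis
`I s` and an output space with orthonormal basis `O s`. -/

variable {S : Type*} (I O : S → Type*)

/-- Basis labels of the tensor product of all input and output spaces. -/
abbrev Idx := ∀ s, I s × O s

/-- Operators on the tensor product of all input and output spaces. -/
abbrev Op := Matrix (Idx I O) (Idx I O) ℂ

/-- A choice, at each site, of an operator on the input-output space of that site. -/
abbrev LocalOps := ∀ s, Matrix (I s × O s) (I s × O s) ℂ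

/-- `M` is the Choi operator of a completely positive trace preserving map from an input space
with basis `a` to an output space with basis `b`: `M ≥ 0` and `tr_out M = 1`. -/
def IsCPTP {a b : Type*} [DecidableEq a] [Fintype b] (M : Matrix (a × b) (a × b) ℂ) : Prop :=
  M.PosSemidef ∧
    (Matrix.of fun i i' => ∑ o, M (i, o) (i', o) : Matrix a a ℂ) = 1

variable {I O} [Fintype S]

/-- The tensor product `⨂ₛ M s` of local operators. -/
def siteTensor (M : LocalOps I O) : Op I O :=
  Matrix.of fun x y => ∏ s, M s (x s) (y s)

variable [DecidableEq S] [∀ s, Fintype (I s)] [∀ s, Fintype (O s)]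
  [∀ s, DecidableEq (I s)] [∀ s, DecidableEq (O s)]

/-- Process matrices: positive operators `W` with `tr [(⨂ₛ M s) W] = 1` for all CPTP maps `M s`. -/
def IsProcessMatrix (W : Op I O) : Prop :=
  W.PosSemidef ∧
    ∀ M : LocalOps I O, (∀ s, IsCPTP (M s)) → (siteTensor M * W).trace = 1

/-- The reduced operator `tr_{Kᶜ} [(1^K ⊗ ⨂_{s ∉ K} M s) W]` on the sites in `K`, as a linear
function of `W`. -/
def reduced (K : Finset S) (M : LocalOps I O) :
    Op I O →ₗ[ℂ] Op (fun s : {s // s ∈ K} => I s) (fun s : {s // s ∈ K} => O s) where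
  toFun W := Matrix.of fun x y =>
    ∑ u : ∀ s : {s // s ∉ K}, I s × O s,
      (siteTensor (fun s => if s ∈ K then 1 else M s) * W)
        ((Equiv.piEquivPiSubtypeProd (· ∈ K) fun s => I s × O s).symm (x, u))
        ((Equiv.piEquivPiSubtypeProd (· ∈ K) fun s => I s × O s).symm (y, u))
  map_add' A B := by
    ext x y
    simp [mul_add, Finset.sum_add_distrib]
  map_smul' c A := by
    ext x y
    simp [Finset.mul_sum]

variable (I O) in
/-- Pairs of choices of CPTP maps that differ at most at the sites in `K₂`. -/
abbrev CPTPPair (K₂ : Finset S) :=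
  {p : LocalOps I O × LocalOps I O //
    (∀ s, IsCPTP (p.1 s)) ∧ (∀ s, IsCPTP (p.2 s)) ∧ ∀ s, s ∉ K₂ → p.1 s = p.2 s}

/-- The linear function `L^{K₁ ≺ K₂}` whose vanishing expresses that there is no signalling from
the sites in `K₂` to the sites in `K₁`: its components are the differences of the reduced
operators on `K₁` for two choices of CPTP maps that differ only at `K₂`. -/
def noSignallingMap (K₁ K₂ : Finset S) :
    Op I O →ₗ[ℂ] (CPTPPair I O K₂ →
      Op (fun s : {s // s ∈ K₁} => I s) (fun s : {s // s ∈ K₁} => O s)) :=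
  LinearMap.pi fun p => reduced K₁ p.1.1 - reduced K₁ p.1.2

/-- The set of sites before position `c`, for sites ordered by `rank`. -/
def before (rank : S → ℕ) (c : ℕ) : Finset S := Finset.univ.filter fun s => rank s < c

/-- The set of sites from position `c` on, for sites ordered by `rank`. -/
def after (rank : S → ℕ) (c : ℕ) : Finset S := Finset.univ.filter fun s => c ≤ rank s

/-- A comb for the total order of the sites given by the injective function `rank`: a process
matrix with no signalling from later sites to earlier sites, for every cut of the order. -/
def IsComb (rank : S → ℕ) (W : Op I O) : Prop :=
  IsProcessMatrix W ∧ ∀ c, noSignallingMap (before rank c) (after rank c) W = 0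

end Sites

section Trials

variable {ι : Type*} {n : ℕ}

/-- The operator `U(σ) X U(σ)†`, where `U(σ)` maps `|μ₁ … μₙ⟩` to `|μ_{σ(1)} … μ_{σ(n)}⟩`. -/
def permuteTrials (σ : Equiv.Perm (Fin n)) (X : Matrix (Fin n → ι) (Fin n → ι) ℂ) :
    Matrix (Fin n → ι) (Fin n → ι) ℂ :=
  X.submatrix (fun x => x ∘ σ.symm) (fun x => x ∘ σ.symm)

/-- The operator `1^{⊗ n} ⊗ M` on `n + 1` trials. -/
def onLastTrial [DecidableEq ι] (n : ℕ) (M : Matrix ι ι ℂ) :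
    Matrix (Fin (n + 1) → ι) (Fin (n + 1) → ι) ℂ :=
  Matrix.of fun x y => (1 : Matrix (Fin n → ι) (Fin n → ι) ℂ) (Fin.init x) (Fin.init y) *
    M (x (Fin.last n)) (y (Fin.last n))

/-- The partial trace over the last of `n + 1` trials. -/
def traceLastTrial [Fintype ι] (X : Matrix (Fin (n + 1) → ι) (Fin (n + 1) → ι) ℂ) :
    Matrix (Fin n → ι) (Fin n → ι) ℂ :=
  Matrix.of fun x y => ∑ a, X (Fin.snoc (α := fun _ => ι) x a) (Fin.snoc (α := fun _ => ι) y a)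

/-- The block of `X` at trial `j` that belongs to the basis vectors `x` (row) and `y` (column) of
the other trials; the values `x j` and `y j` are not used. Thus
`X = ∑ₓᵧ trialBlock j X x y ⊗ |x⟩⟨y|`, the sum being over labels of the trials other than `j`. -/
def trialBlock (j : Fin n) (X : Matrix (Fin n → ι) (Fin n → ι) ℂ) (x y : Fin n → ι) :
    Matrix ι ι ℂ :=
  Matrix.of fun a b => X (Function.update x j a) (Function.update y j b)

/-- For a complex linear function `L` of single-trial operators, the value at `X` of the function
`𝓘 ⊗ ⋯ ⊗ L ⊗ ⋯ ⊗ 𝓘`, with `L` in position `j`: the array of the coefficients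
`L (trialBlock j X x y)` of the operators `|x⟩⟨y|` of the other trials. -/
def applyAtTrial {V : Type*} (j : Fin n) (L : Matrix ι ι ℂ → V)
    (X : Matrix (Fin n → ι) (Fin n → ι) ℂ) : (Fin n → ι) → (Fin n → ι) → V :=
  fun x y => L (trialBlock j X x y)

/-- The complex linear extension to all operators of a real linear function on self-adjoint
operators, with values in the complexification `V × V ≅ V ⊕ iV`. -/
def complexExtension [Fintype ι] [DecidableEq ι] {V : Type*} [AddCommGroup V] [Module ℝ V]
    (L : selfAdjoint (Matrix ι ι ℂ) →ₗ[ℝ] V) (A : Matrix ι ι ℂ) : V × V :=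
  (L (realPart A), L (imaginaryPart A))

end Trials

section Exchangeable

variable {S : Type*} {I O : S → Type*}

/-- An operator on `n` trials with sites `S`, regarded as an operator of a one-shot scenario
with the sites `Fin n × S`. -/
def asOneShot {n : ℕ} (X : Matrix (Fin n → Idx I O) (Fin n → Idx I O) ℂ) :
    Op (fun p : Fin n × S => I p.2) (fun p : Fin n × S => O p.2) :=
  X.submatrix (fun z j s => z (j, s)) (fun z j s => z (j, s))

variable [Fintype S] [DecidableEq S] [∀ s, Fintype (I s)] [∀ s, Fintype (O s)]
  [∀ s, DecidableEq (I s)] [∀ s, DecidableEq (O s)]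

/-- Exchangeable sequences `W⁽ⁿ⁾`, `n ≥ 1`, of process matrices (the value at `n = 0` is not
used). A CPTP map of a trial is a tensor product of CPTP maps at the sites of the trial. -/
structure IsExchangeable (W : ∀ n : ℕ, Matrix (Fin n → Idx I O) (Fin n → Idx I O) ℂ) : Prop where
  process : ∀ n, 1 ≤ n → IsProcessMatrix (asOneShot (W n))
  symmetric : ∀ n, 1 ≤ n → ∀ σ : Equiv.Perm (Fin n), permuteTrials σ (W n) = W n
  extendible : ∀ n, 1 ≤ n → ∀ M : LocalOps I O, (∀ s, IsCPTP (M s)) →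
    W n = traceLastTrial (W (n + 1) * onLastTrial n (siteTensor M))

/-- `P` is a probability measure on single-trial process matrices with `W⁽ⁿ⁾ = ∫ w^{⊗ n} dP(w)`
for all `n ≥ 1` (entrywise). The integrands are continuous, and the set of process matrices
is compact. -/
structure IsDeFinettiMeasure (W : ∀ n : ℕ, Matrix (Fin n → Idx I O) (Fin n → Idx I O) ℂ)
    (P : Measure (Op I O)) : Prop where
  prob : IsProbabilityMeasure P
  process : ∀ᵐ w ∂P, IsProcessMatrix w
  mixture : ∀ n, 1 ≤ n → ∀ x y, W n x y = ∫ w, ∏ i, w (x i) (y i) ∂P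

/-- `W⁽ⁿ⁾` has a unique representation as a mixture of i.i.d. process matrices, and the mixture
is supported on `C`. -/
def HasUniqueDeFinetti (W : ∀ n : ℕ, Matrix (Fin n → Idx I O) (Fin n → Idx I O) ℂ)
    (C : Set (Op I O)) : Prop :=
  ∃ P : Measure (Op I O), IsDeFinettiMeasure W P ∧ (∀ᵐ w ∂P, w ∈ C) ∧
    ∀ Q : Measure (Op I O), IsDeFinettiMeasure W Q → Q = P

end Exchangeable

end ProcessDeFinetti

end

/-! By symmetry the entry of `W n` at `x`, `y` depends only on the multiset of pairs `(x i, y i)`.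
The whole sequence is therefore one function `X` on multisets of matrix positions, and extendibility
says that contracting one trial with a product of CPTP maps leaves `X` unchanged.

Existence is a Krein–Milman argument. A positive multiple `δ • 1` of the identity is a product of
depolarizing maps, so traces, and with them all entries, are bounded: the normalized consistent `X`
form a compact convex set. If `0 ≤ E ≤ δ • 1`, contracting an extreme `X` with `E` and with `δ • 1 -
E` splits it into two consistent summands, so each is a multiple of `X`. Such `E` span all
operators, hence `X` is the moment function of a single process matrix
(`exists_moment_of_mem_extremePoints`). The mixtures of these form a compact convex set and so
exhaust the base (`exists_probabilityMeasure_moment`). Uniqueness is Stone–Weierstrass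
(`measure_ext_of_moment`).

For the constraints, a second trial serves as a copy. If a linear functional `g` kills the blocks of
one trial, then `g w` integrates to zero against the entries of another `w`. As `w` is Hermitian,
the conjugate of `g w` is a linear combination of such entries, so the integral of `|g w|²` vanishes
and `g w = 0` almost surely (`ae_dual_eq_zero`).

A global comb is treated in the same spirit: of two trials, the one whose relevant site comes later
carries the signalling difference, and the other, on sites before the same cut, carries its
conjugate (`IsDeFinettiMeasure.ae_noSignalling_of_comb`). -/

noncomputable section

set_option linter.unusedSectionVars false

namespace ProcessDeFinetti

/-! ### Positive semidefinite matrices: span, scaling and entry bounds. -/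

section PosSemidef

open scoped MatrixOrder Matrix.Norms.L2Operator

variable {ι : Type*} [Fintype ι] [DecidableEq ι]

theorem span_posSemidef_eq_top :
    Submodule.span ℂ {E : Matrix ι ι ℂ | E.PosSemidef} = ⊤ := by
  have := CStarAlgebra.span_nonneg (A := Matrix ι ι ℂ)
  simpa only [Matrix.nonneg_iff_posSemidef] using this

theorem exists_smul_le_one {E : Matrix ι ι ℂ} (hE : E.PosSemidef) :
    ∃ t : ℝ, 0 < t ∧ (1 - (t : ℂ) • E).PosSemidef := by
  have h1 : E ≤ algebraMap ℝ (Matrix ι ι ℂ) ‖E‖ :=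
    IsSelfAdjoint.le_algebraMap_norm_self (a := E) hE.1
  -- The summand `1` keeps the scale finite for `E = 0`; the rest is `E ≤ ‖E‖ • 1`.
  refine ⟨(‖E‖ + 1)⁻¹, by positivity, ?_⟩
  have h4 : (((‖E‖ + 1 : ℝ) : ℂ)) ≠ 0 := by
    have : ‖E‖ + 1 ≠ 0 := by positivity
    exact_mod_cast this
  have h3 := ((Matrix.le_iff.1 h1).add (Matrix.PosSemidef.one (n := ι) (R := ℂ))).smul
    (a := (((‖E‖ + 1)⁻¹ : ℝ) : ℂ)) (by exact_mod_cast (by positivity : (0:ℝ) ≤ (‖E‖+1)⁻¹))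
  have h5 : (1 - (((‖E‖ + 1)⁻¹ : ℝ) : ℂ) • E : Matrix ι ι ℂ) =
      (((‖E‖ + 1)⁻¹ : ℝ) : ℂ) • (algebraMap ℝ (Matrix ι ι ℂ) ‖E‖ - E + 1) := by
    rw [Algebra.algebraMap_eq_smul_one]
    ext i j
    simp only [Matrix.add_apply, Matrix.sub_apply, Matrix.smul_apply, smul_eq_mul,
      Complex.real_smul]
    push_cast at h4 ⊢
    field_simp
    ring
  rw [h5]
  exact h3

theorem exists_eq_conjTranspose_mul_self {E : Matrix ι ι ℂ} (hE : E.PosSemidef) :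
    ∃ A : Matrix ι ι ℂ, E = A.conjTranspose * A := by
  simpa only [Matrix.star_eq_conjTranspose] using
    CStarAlgebra.nonneg_iff_eq_star_mul_self.1 hE.nonneg

/-- Writing `E = A† A`, the arithmetic–geometric mean inequality bounds an entry by the mean of two
diagonal entries, and each of these is at most the trace. -/
theorem norm_apply_le_trace {E : Matrix ι ι ℂ} (hE : E.PosSemidef) (i j : ι) :
    ‖E i j‖ ≤ E.trace.re := by
  obtain ⟨A, rfl⟩ := exists_eq_conjTranspose_mul_self hE
  have hd : ∀ l, ((A.conjTranspose * A) l l).re = ∑ k, ‖A k l‖ ^ 2 := by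
    intro l
    simp only [Matrix.mul_apply, Matrix.conjTranspose_apply, Complex.re_sum]
    refine Finset.sum_congr rfl fun k _ => ?_
    rw [Complex.star_def, Complex.conj_mul']
    norm_cast
  have hle : ∀ l, ∑ k, ‖A k l‖ ^ 2 ≤ (A.conjTranspose * A).trace.re := by
    intro l
    simp only [Matrix.trace, Matrix.diag_apply, Complex.re_sum, hd]
    exact Finset.single_le_sum (f := fun l => ∑ k, ‖A k l‖ ^ 2)
      (fun l _ => Finset.sum_nonneg fun k _ => by positivity) (Finset.mem_univ l)
  have hb : ‖(A.conjTranspose * A) i j‖ ≤ (∑ k, ‖A k i‖ ^ 2 + ∑ k, ‖A k j‖ ^ 2) / 2 := by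
    rw [Matrix.mul_apply, ← Finset.sum_add_distrib, Finset.sum_div]
    refine (norm_sum_le _ _).trans (Finset.sum_le_sum fun k _ => ?_)
    simp only [Matrix.conjTranspose_apply, norm_mul, norm_star]
    nlinarith [sq_nonneg (‖A k i‖ - ‖A k j‖)]
  linarith [hle i, hle j]

end PosSemidef

/-! ### The cone of consistent symmetric sequences, as functions of multisets. -/

section Cone

variable {ι : Type*}

/-- The multiset of matrix positions `(x i, y i)`. -/
def pairs {n : ℕ} (x y : Fin n → ι) : Multiset (ι × ι) := List.ofFn fun i => (x i, y i)

/-- The `n`-trial operator encoded by a function of multisets of matrix positions. -/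
def level (X : Multiset (ι × ι) → ℂ) (n : ℕ) : Matrix (Fin n → ι) (Fin n → ι) ℂ :=
  Matrix.of fun x y => X (pairs x y)

@[simp] theorem pairs_cons {n : ℕ} (x y : Fin n → ι) (a b : ι) :
    pairs (Fin.cons a x : Fin (n + 1) → ι) (Fin.cons b y) = (a, b) ::ₘ pairs x y := by
  simp [pairs, List.ofFn_succ]

@[simp] theorem pairs_zero (x y : Fin 0 → ι) : pairs x y = 0 := by
  simp [pairs]

theorem exists_pairs (s : Multiset (ι × ι)) : ∃ x y : Fin s.card → ι, s = pairs x y := by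
  induction s using Multiset.induction_on with
  | empty => exact ⟨Fin.elim0, Fin.elim0, by simp⟩
  | cons p s ih =>
    obtain ⟨x, y, h⟩ := ih
    rw [Multiset.card_cons]
    exact ⟨Fin.cons p.1 x, Fin.cons p.2 y, by rw [pairs_cons, ← h]⟩

variable [Fintype ι]

/-- The sequence of operators obtained by contracting one trial with the operator `E`. -/
def contract (E : Matrix ι ι ℂ) : (Multiset (ι × ι) → ℂ) →ₗ[ℂ] (Multiset (ι × ι) → ℂ) where
  toFun X s := ∑ a, ∑ b, E b a * X ((a, b) ::ₘ s)
  map_add' X Y := by ext s; simp [mul_add, Finset.sum_add_distrib]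
  map_smul' c X := by ext s; simp [Finset.mul_sum, mul_left_comm]

theorem contract_apply (E : Matrix ι ι ℂ) (X : Multiset (ι × ι) → ℂ) (s : Multiset (ι × ι)) :
    contract E X s = ∑ a, ∑ b, E b a * X ((a, b) ::ₘ s) := rfl

theorem contract_add (E F : Matrix ι ι ℂ) (X : Multiset (ι × ι) → ℂ) :
    contract (E + F) X = contract E X + contract F X := by
  ext s; simp [contract_apply, add_mul, Finset.sum_add_distrib]

theorem contract_smul (c : ℂ) (E : Matrix ι ι ℂ) (X : Multiset (ι × ι) → ℂ) :
    contract (c • E) X = c • contract E X := by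
  ext s; simp [contract_apply, Finset.mul_sum, mul_assoc]

/-- Multisets are unordered, so it does not matter which trial is contracted first. This is what
makes contraction preserve consistency. -/
theorem contract_comm (E F : Matrix ι ι ℂ) (X : Multiset (ι × ι) → ℂ) :
    contract E (contract F X) = contract F (contract E X) := by
  ext s
  have h : ∀ E F : Matrix ι ι ℂ, contract E (contract F X) s =
      ∑ p : ι × ι, ∑ q : ι × ι, E p.2 p.1 * F q.2 q.1 * X (q ::ₘ p ::ₘ s) := by
    intro E F
    simp only [contract_apply, Fintype.sum_prod_type, Finset.mul_sum, mul_assoc]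
  rw [h, h, Finset.sum_comm]
  refine Finset.sum_congr rfl fun p _ => Finset.sum_congr rfl fun q _ => ?_
  rw [Multiset.cons_swap, mul_comm (E q.2 q.1)]

theorem contract_single [DecidableEq ι] (a b : ι) (X : Multiset (ι × ι) → ℂ)
    (s : Multiset (ι × ι)) : contract (Matrix.single b a 1) X s = X ((a, b) ::ₘ s) := by
  rw [contract_apply, Finset.sum_eq_single a, Finset.sum_eq_single b]
  · simp
  · intro b' _ hb; simp [Matrix.single, hb.symm]
  · simp
  · intro a' _ ha; simp [Matrix.single, ha.symm]
  · simp

theorem sum_cons {n : ℕ} {R : Type*} [AddCommMonoid R] (f : (Fin (n + 1) → ι) → R) :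
    ∑ z, f z = ∑ a, ∑ x : Fin n → ι, f (Fin.cons a x) := by
  rw [← (Fin.consEquiv fun _ : Fin (n + 1) => ι).sum_comp, Fintype.sum_prod_type]
  rfl

theorem posSemidef_level_contract [DecidableEq ι] {X : Multiset (ι × ι) → ℂ}
    (hX : ∀ n, (level X n).PosSemidef) {E : Matrix ι ι ℂ} (hE : E.PosSemidef) (n : ℕ) :
    (level (contract E X) n).PosSemidef := by
  obtain ⟨A, rfl⟩ := exists_eq_conjTranspose_mul_self hE
  -- With `E = A† A`, `V k` attaches the conjugate of row `k` of `A` as an extra trial, so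
  -- contraction is a sum of congruences `V† X V`.
  let V : ι → Matrix (Fin (n + 1) → ι) (Fin n → ι) ℂ := fun k =>
    Matrix.of fun z y => if Fin.tail z = y then star (A k (z 0)) else 0
  have h : level (contract (A.conjTranspose * A) X) n =
      ∑ k, (V k).conjTranspose * level X (n + 1) * V k := by
    ext x y
    have hk : ∀ k, ((V k).conjTranspose * level X (n + 1) * V k) x y =
        ∑ a, ∑ b, star (A k b) * A k a * X ((a, b) ::ₘ pairs x y) := by
      intro k
      simp only [level, Matrix.of_apply, Matrix.mul_apply,
        Matrix.conjTranspose_apply, V, sum_cons, Fin.tail_cons, Fin.cons_zero, pairs_cons,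
        apply_ite star, star_star, star_zero, ite_mul, zero_mul, mul_ite, mul_zero,
        Finset.sum_ite_eq', Finset.mem_univ, if_true, Finset.sum_mul]
      rw [Finset.sum_comm]
      exact Finset.sum_congr rfl fun a _ => Finset.sum_congr rfl fun b _ => by ring
    rw [Matrix.sum_apply, Finset.sum_congr rfl fun k _ => hk k, Finset.sum_comm]
    simp only [level, Matrix.of_apply, contract_apply, Matrix.mul_apply,
      Matrix.conjTranspose_apply, Finset.sum_mul]
    refine Finset.sum_congr rfl fun a _ => Finset.sum_comm
  rw [h]
  exact Matrix.posSemidef_sum _ fun k _ => (hX (n + 1)).conjTranspose_mul_mul_same (V k)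

/-- Symmetric sequences of positive operators that are consistent with respect to the
operators `M ∈ 𝓜` (that is, exchangeable up to normalization). -/
structure IsConsistent (𝓜 : Set (Matrix ι ι ℂ)) (X : Multiset (ι × ι) → ℂ) : Prop where
  posSemidef : ∀ n, (level X n).PosSemidef
  contract_eq : ∀ M ∈ 𝓜, contract M X = X

theorem IsConsistent.contract [DecidableEq ι] {𝓜 : Set (Matrix ι ι ℂ)} {X : Multiset (ι × ι) → ℂ}
    (hX : IsConsistent 𝓜 X) {E : Matrix ι ι ℂ} (hE : E.PosSemidef) :
    IsConsistent 𝓜 (contract E X) where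
  posSemidef := posSemidef_level_contract hX.posSemidef hE
  contract_eq M hM := by rw [contract_comm, hX.contract_eq M hM]

/-- Consistency with `δ • 1` makes tracing out a trial multiply by `δ⁻¹`, which fixes the trace at
every level, and the trace bounds the entries. In particular `X 0 = 0` forces `X = 0`. -/
theorem IsConsistent.norm_le [DecidableEq ι] {𝓜 : Set (Matrix ι ι ℂ)} {δ : ℝ} (hδ : 0 < δ)
    (h𝓜 : (δ : ℂ) • (1 : Matrix ι ι ℂ) ∈ 𝓜) {X : Multiset (ι × ι) → ℂ}
    (hX : IsConsistent 𝓜 X) (s : Multiset (ι × ι)) :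
    ‖X s‖ ≤ δ⁻¹ ^ s.card * (X 0).re := by
  have hδ' : (δ : ℂ) ≠ 0 := by exact_mod_cast hδ.ne'
  have hsum : ∀ s, ∑ a, X ((a, a) ::ₘ s) = (δ : ℂ)⁻¹ * X s := by
    intro s
    have := congrFun (hX.contract_eq _ h𝓜) s
    rw [← this, contract_smul, Pi.smul_apply, smul_eq_mul, inv_mul_cancel_left₀ hδ']
    simp [contract_apply, Matrix.one_apply]
  have htr : ∀ n, (level X n).trace = (δ : ℂ)⁻¹ ^ n * X 0 := by
    intro n
    induction n with
    | zero => simp [Matrix.trace, level]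
    | succ n ih =>
      have : (level X (n + 1)).trace = (δ : ℂ)⁻¹ * (level X n).trace := by
        simp only [Matrix.trace, Matrix.diag_apply, level, Matrix.of_apply, sum_cons, pairs_cons]
        rw [Finset.sum_comm, Finset.mul_sum]
        exact Finset.sum_congr rfl fun x _ => hsum _
      rw [this, ih, pow_succ']
      ring
  obtain ⟨x, y, h⟩ := exists_pairs s
  have := norm_apply_le_trace (hX.posSemidef s.card) x y
  rw [htr] at this
  have h2 : ((δ : ℂ)⁻¹ ^ s.card * X 0).re = δ⁻¹ ^ s.card * (X 0).re := by
    rw [← Complex.ofReal_inv, ← Complex.ofReal_pow, Complex.re_ofReal_mul]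
  rw [h2] at this
  rwa [level, Matrix.of_apply, ← h] at this

end Cone

/-! ### The compact convex base of the cone and its extreme points. -/

section Base

variable {ι : Type*}

/-- The product sequence of the operator `w`. -/
def moment (w : Matrix ι ι ℂ) (s : Multiset (ι × ι)) : ℂ := (s.map fun p => w p.1 p.2).prod

@[simp] theorem moment_zero (w : Matrix ι ι ℂ) : moment w 0 = 1 := by simp [moment]

@[simp] theorem moment_cons (w : Matrix ι ι ℂ) (p : ι × ι) (s : Multiset (ι × ι)) :
    moment w (p ::ₘ s) = w p.1 p.2 * moment w s := by simp [moment]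

theorem moment_pairs (w : Matrix ι ι ℂ) {n : ℕ} (x y : Fin n → ι) :
    moment w (pairs x y) = ∏ i, w (x i) (y i) := by
  simp [moment, pairs, List.prod_ofFn]

variable [Fintype ι]

theorem isClosed_setOf_posSemidef : IsClosed {A : Matrix ι ι ℂ | A.PosSemidef} := by
  have : {A : Matrix ι ι ℂ | A.PosSemidef} =
      {A | A.conjTranspose = A} ∩ ⋂ v : ι → ℂ, {A | 0 ≤ star v ⬝ᵥ A.mulVec v} := by
    ext A
    simp [Matrix.posSemidef_iff_dotProduct_mulVec, Matrix.IsHermitian]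
  rw [this]
  refine (isClosed_eq (by fun_prop) continuous_id).inter (isClosed_iInter fun v => ?_)
  exact isClosed_le continuous_const (by fun_prop)

/-- Normalized consistent sequences. -/
def consistentBase (𝓜 : Set (Matrix ι ι ℂ)) : Set (Multiset (ι × ι) → ℂ) :=
  {X | IsConsistent 𝓜 X ∧ X 0 = 1}

theorem IsConsistent.add {𝓜 : Set (Matrix ι ι ℂ)} {X Y : Multiset (ι × ι) → ℂ}
    (hX : IsConsistent 𝓜 X) (hY : IsConsistent 𝓜 Y) : IsConsistent 𝓜 (X + Y) where
  posSemidef n := (hX.posSemidef n).add (hY.posSemidef n)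
  contract_eq M hM := by rw [map_add, hX.contract_eq M hM, hY.contract_eq M hM]

theorem IsConsistent.smul {𝓜 : Set (Matrix ι ι ℂ)} {X : Multiset (ι × ι) → ℂ}
    (hX : IsConsistent 𝓜 X) {t : ℝ} (ht : 0 ≤ t) : IsConsistent 𝓜 (t • X) where
  posSemidef n := by
    have h : level (t • X) n = (t : ℂ) • level X n := by ext; simp [level]
    rw [h]
    exact (hX.posSemidef n).smul (by exact_mod_cast ht)
  contract_eq M hM := by
    rw [← Complex.coe_smul, map_smul, hX.contract_eq M hM]

theorem convex_consistentBase (𝓜 : Set (Matrix ι ι ℂ)) : Convex ℝ (consistentBase 𝓜) := by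
  intro X hX Y hY a b ha hb hab
  refine ⟨(hX.1.smul ha).add (hY.1.smul hb), ?_⟩
  simp only [Pi.add_apply, Pi.smul_apply, hX.2, hY.2, Complex.real_smul, mul_one]
  exact_mod_cast hab

theorem isClosed_consistentBase (𝓜 : Set (Matrix ι ι ℂ)) : IsClosed (consistentBase 𝓜) := by
  have : consistentBase 𝓜 = ((⋂ n, (fun X => level X n) ⁻¹' {A | A.PosSemidef}) ∩
      ⋂ M ∈ 𝓜, {X | contract M X = X}) ∩ {X | X 0 = 1} := by
    ext X
    simp only [consistentBase, Set.mem_inter_iff, Set.mem_iInter, Set.mem_preimage,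
      Set.mem_ofPred_eq]
    exact ⟨fun h => ⟨⟨h.1.1, h.1.2⟩, h.2⟩, fun h => ⟨⟨h.1.1, h.1.2⟩, h.2⟩⟩
  rw [this]
  refine ((isClosed_iInter fun n => isClosed_setOf_posSemidef.preimage ?_).inter
    (isClosed_biInter fun M _ => isClosed_eq ?_ continuous_id)).inter
      (isClosed_eq (continuous_apply 0) continuous_const)
  · exact continuous_pi fun x => continuous_pi fun y => continuous_apply _
  · refine continuous_pi fun s => ?_
    simp only [contract_apply]
    exact continuous_finsetSum _ fun a _ => continuous_finsetSum _ fun b _ =>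
      continuous_const.mul (continuous_apply _)

theorem isCompact_consistentBase [DecidableEq ι] {𝓜 : Set (Matrix ι ι ℂ)} {δ : ℝ} (hδ : 0 < δ)
    (h𝓜 : (δ : ℂ) • (1 : Matrix ι ι ℂ) ∈ 𝓜) : IsCompact (consistentBase 𝓜) := by
  refine (isCompact_univ_pi fun s : Multiset (ι × ι) =>
    isCompact_closedBall (0 : ℂ) (δ⁻¹ ^ s.card)).of_isClosed_subset
      (isClosed_consistentBase 𝓜) fun X hX s _ => ?_
  simpa [hX.2] using hX.1.norm_le hδ h𝓜 s

/-- Positive operators that are normalized with respect to all `M ∈ 𝓜`. -/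
def stateSpace (𝓜 : Set (Matrix ι ι ℂ)) : Set (Matrix ι ι ℂ) :=
  {w | w.PosSemidef ∧ ∀ M ∈ 𝓜, (M * w).trace = 1}

theorem isCompact_stateSpace [DecidableEq ι] {𝓜 : Set (Matrix ι ι ℂ)} {δ : ℝ}
    (h𝓜 : (δ : ℂ) • (1 : Matrix ι ι ℂ) ∈ 𝓜) : IsCompact (stateSpace 𝓜) := by
  have hc : IsClosed (stateSpace 𝓜) := by
    have : stateSpace 𝓜 = {A | A.PosSemidef} ∩ ⋂ M ∈ 𝓜, {w | (M * w).trace = 1} := by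
      ext; simp [stateSpace]
    rw [this]
    refine isClosed_setOf_posSemidef.inter
      (isClosed_biInter fun M _ => isClosed_eq (by fun_prop) continuous_const)
  refine (isCompact_univ_pi fun _ : ι => isCompact_univ_pi fun _ : ι =>
    isCompact_closedBall (0 : ℂ) δ⁻¹).of_isClosed_subset hc fun (w : Matrix ι ι ℂ) hw a _ b _ => ?_
  have h1 := norm_apply_le_trace hw.1 a b
  have h2 := hw.2 _ h𝓜
  rw [Matrix.smul_mul, one_mul, Matrix.trace_smul, smul_eq_mul] at h2
  have h3 : δ * w.trace.re = 1 := by simpa using congrArg Complex.re h2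
  have h4 : w.trace.re = δ⁻¹ := eq_inv_of_mul_eq_one_right h3
  simpa [h4] using h1

theorem exists_moment_of_mem_extremePoints [DecidableEq ι] {𝓜 : Set (Matrix ι ι ℂ)} {δ : ℝ}
    (hδ : 0 < δ) (h𝓜 : (δ : ℂ) • (1 : Matrix ι ι ℂ) ∈ 𝓜) {X : Multiset (ι × ι) → ℂ}
    (hX : X ∈ (consistentBase 𝓜).extremePoints ℝ) : ∃ w ∈ stateSpace 𝓜, X = moment w := by
  have hδ' : (δ : ℂ) ≠ 0 := by exact_mod_cast hδ.ne'
  obtain ⟨⟨hXc, hX0⟩, hext⟩ := hX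
  have hzero : ∀ Y : Multiset (ι × ι) → ℂ, IsConsistent 𝓜 Y → Y 0 = 0 → Y = 0 := by
    intro Y hY h0
    ext s
    have := hY.norm_le hδ h𝓜 s
    rw [h0] at this
    simpa using this
  have hpos : ∀ Y : Multiset (ι × ι) → ℂ, IsConsistent 𝓜 Y → ∃ c : ℝ, 0 ≤ c ∧ Y 0 = c := by
    intro Y hY
    have h := (hY.posSemidef 0).diag_nonneg (i := Fin.elim0)
    rw [level, Matrix.of_apply, pairs_zero] at h
    obtain ⟨h1, h2⟩ := Complex.le_def.1 h
    exact ⟨(Y 0).re, h1, Complex.ext rfl h2.symm⟩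
  have hsmall : ∀ E : Matrix ι ι ℂ, E.PosSemidef → ((δ : ℂ) • 1 - E).PosSemidef →
      contract E X = contract E X 0 • X := by
    intro E hE hE'
    have hY := hXc.contract hE
    have hZ := hXc.contract hE'
    have hYZ : contract E X + contract ((δ : ℂ) • 1 - E) X = X := by
      rw [← contract_add, add_sub_cancel, hXc.contract_eq _ h𝓜]
    generalize contract E X = Y at *
    generalize contract ((δ : ℂ) • 1 - E) X = Z at *
    obtain ⟨c, hc, hYc⟩ := hpos Y hY
    obtain ⟨d, hd, hZd⟩ := hpos Z hZ
    have hcd : c + d = 1 := by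
      have := congrFun hYZ 0
      rw [Pi.add_apply, hYc, hZd, hX0] at this
      exact_mod_cast this
    -- A summand of weight zero vanishes identically by the norm bound; otherwise both can be
    -- normalized and extremality applies.
    rcases hc.eq_or_lt with rfl | hc
    · have := hzero Y hY (by rw [hYc]; simp)
      subst this
      simp
    rcases hd.eq_or_lt with rfl | hd
    · have := hzero Z hZ (by rw [hZd]; simp)
      subst this
      rw [hYc, ← hYZ]
      have : c = 1 := by linarith
      simp [this]
    have hmem : ∀ (Y : Multiset (ι × ι) → ℂ) (c : ℝ), 0 < c → Y 0 = c → IsConsistent 𝓜 Y →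
        c⁻¹ • Y ∈ consistentBase 𝓜 := by
      intro Y c hc hYc hY
      refine ⟨hY.smul (inv_nonneg.2 hc.le), ?_⟩
      have : (c : ℂ) ≠ 0 := by exact_mod_cast hc.ne'
      simp [hYc, this]
    have := hext (hmem Y c hc hYc hY) (hmem Z d hd hZd hZ)
      ⟨c, d, hc, hd, hcd, by
        rw [smul_inv_smul₀ hc.ne', smul_inv_smul₀ hd.ne', hYZ]⟩
    rw [hYc, ← this, Complex.coe_smul, smul_inv_smul₀ hc.ne']
  have hall : ∀ E : Matrix ι ι ℂ, contract E X = contract E X 0 • X := by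
    intro E
    have hE : E ∈ Submodule.span ℂ {E : Matrix ι ι ℂ | E.PosSemidef} := by
      rw [span_posSemidef_eq_top]; trivial
    induction hE using Submodule.span_induction with
    -- A positive `E` is scaled below `δ • 1`, and the scale is cancelled afterwards.
    | mem E hE =>
      obtain ⟨t, ht, hle⟩ := exists_smul_le_one hE
      have hδt : (0 : ℂ) ≤ (δ : ℂ) * (t : ℂ) := by exact_mod_cast (mul_pos hδ ht).le
      have hδ0 : (0 : ℂ) ≤ (δ : ℂ) := by exact_mod_cast hδ.le
      have h := hsmall (((δ : ℂ) * t) • E) (hE.smul hδt) (by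
        have := hle.smul hδ0
        rwa [smul_sub, smul_smul] at this)
      have hne : (δ : ℂ) * t ≠ 0 := mul_ne_zero hδ' (by exact_mod_cast ht.ne')
      rw [contract_smul, Pi.smul_apply, smul_assoc] at h
      exact smul_right_injective _ hne h
    | zero =>
      have : contract (0 : Matrix ι ι ℂ) X = 0 := by ext; simp [contract_apply]
      simp [this]
    | add E F _ _ hE hF => rw [contract_add, hE, hF, Pi.add_apply, add_smul]; simp [hX0]
    | smul c E _ hE => rw [contract_smul, hE]; simp [hX0, smul_smul]
  -- The operator is the one-trial level of `X`. Contraction with matrix units then peels off one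
  -- factor at a time.
  refine ⟨Matrix.of fun a b => X {(a, b)}, ⟨?_, fun M hM => ?_⟩, ?_⟩
  · have := (hXc.posSemidef 1).submatrix fun a : ι => fun _ : Fin 1 => a
    convert this using 1
    ext a b
    simp [level, pairs]
  · have := congrFun (hXc.contract_eq M hM) 0
    rw [hX0, contract_apply, Finset.sum_comm] at this
    simpa [Matrix.trace, Matrix.mul_apply] using this
  · ext s
    induction s using Multiset.induction_on with
    | empty => simp [hX0]
    | cons p s ih =>
      have := congrFun (hall (Matrix.single p.2 p.1 1)) s
      rw [Pi.smul_apply, contract_single, contract_single] at this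
      rw [moment_cons, ← ih]
      exact this

end Base

/-! ### Representing measures: existence and uniqueness. -/

section Mixture

variable {ι : Type*}

theorem continuous_moment (s : Multiset (ι × ι)) :
    Continuous fun w : Matrix ι ι ℂ => moment w s := by
  induction s using Multiset.induction_on with
  | empty => simpa using continuous_const
  | cons p s ih =>
    simp only [moment_cons]
    exact (by fun_prop : Continuous fun w : Matrix ι ι ℂ => w p.1 p.2).mul ih

variable [Fintype ι]

theorem exists_probabilityMeasure_moment [DecidableEq ι] {𝓜 : Set (Matrix ι ι ℂ)} {δ : ℝ}
    (hδ : 0 < δ) (h𝓜 : (δ : ℂ) • (1 : Matrix ι ι ℂ) ∈ 𝓜) {X : Multiset (ι × ι) → ℂ}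
    (hX : X ∈ consistentBase 𝓜) :
    ∃ P : Measure (Matrix ι ι ℂ), IsProbabilityMeasure P ∧ (∀ᵐ w ∂P, w ∈ stateSpace 𝓜) ∧
      ∀ s, X s = ∫ w, moment w s ∂P := by
  have hK := isCompact_stateSpace h𝓜
  have : CompactSpace (stateSpace 𝓜) := isCompact_iff_compactSpace.1 hK
  have : T2Space (Matrix ι ι ℂ) := inferInstanceAs (T2Space (ι → ι → ℂ))
  let F : Multiset (ι × ι) → BoundedContinuousFunction (stateSpace 𝓜) ℂ := fun s =>
    BoundedContinuousFunction.mkOfCompact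
      ⟨fun w => moment w.1 s, (continuous_moment s).comp continuous_subtype_val⟩
  -- The barycentre map. Its range is convex, compact because the probability measures on a compact
  -- space are, and contains the extreme points as images of Dirac measures.
  let Φ : ProbabilityMeasure (stateSpace 𝓜) → Multiset (ι × ι) → ℂ := fun P s =>
    ∫ w, F s w ∂(P : Measure (stateSpace 𝓜))
  have hΦ : Continuous Φ := by
    refine continuous_pi fun s => continuous_iff_continuousAt.2 fun P => ?_
    exact (ProbabilityMeasure.tendsto_iff_forall_integral_rclike_tendsto ℂ).1
      Filter.tendsto_id (F s)
  have hconv : Convex ℝ (Set.range Φ) := by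
    rintro _ ⟨P, rfl⟩ _ ⟨Q, rfl⟩ a b ha hb hab
    let ν : Measure (stateSpace 𝓜) :=
      ENNReal.ofReal a • (P : Measure (stateSpace 𝓜)) + ENNReal.ofReal b • (Q : Measure _)
    have hν : IsProbabilityMeasure ν := ⟨by
      simp [ν, ← ENNReal.ofReal_add ha hb, hab]⟩
    refine ⟨⟨ν, hν⟩, ?_⟩
    ext s
    change ∫ w, F s w ∂ν = _
    have hi : ∀ μ : Measure (stateSpace 𝓜), IsFiniteMeasure μ → Integrable (F s) μ :=
      fun μ _ => (F s).integrable μ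
    rw [integral_add_measure ((hi _ inferInstance).smul_measure ENNReal.ofReal_ne_top)
      ((hi _ inferInstance).smul_measure ENNReal.ofReal_ne_top), integral_smul_measure,
      integral_smul_measure, ENNReal.toReal_ofReal ha, ENNReal.toReal_ofReal hb]
    rfl
  have hext : (consistentBase 𝓜).extremePoints ℝ ⊆ Set.range Φ := by
    intro Y hY
    obtain ⟨w, hw, rfl⟩ := exists_moment_of_mem_extremePoints hδ h𝓜 hY
    refine ⟨⟨Measure.dirac ⟨w, hw⟩, inferInstance⟩, ?_⟩
    ext s
    change ∫ w, F s w ∂(Measure.dirac _) = _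
    rw [integral_dirac]
    rfl
  have hrange : X ∈ Set.range Φ := by
    have h := closure_convexHull_extremePoints (isCompact_consistentBase hδ h𝓜)
      (convex_consistentBase 𝓜)
    rw [← h] at hX
    exact closure_minimal (convexHull_min hext hconv) (isCompact_range hΦ).isClosed hX
  obtain ⟨P, rfl⟩ := hrange
  refine ⟨(P : Measure (stateSpace 𝓜)).map Subtype.val,
    Measure.isProbabilityMeasure_map measurable_subtype_coe.aemeasurable, ?_, fun s => ?_⟩
  · refine (ae_map_iff (p := (· ∈ stateSpace 𝓜)) measurable_subtype_coe.aemeasurable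
      hK.isClosed.measurableSet).2 ?_
    exact Filter.Eventually.of_forall fun w => w.2
  · rw [(MeasurableEmbedding.subtype_coe hK.isClosed.measurableSet).integral_map]
    rfl

/-- Moments span a point-separating star subalgebra of the continuous functions on a compact space.
Closure under conjugation holds because states are Hermitian: conjugating swaps row and column. -/
theorem measure_ext_of_moment [DecidableEq ι] {𝓜 : Set (Matrix ι ι ℂ)} {δ : ℝ}
    (h𝓜 : (δ : ℂ) • (1 : Matrix ι ι ℂ) ∈ 𝓜) {P Q : Measure (Matrix ι ι ℂ)}
    [IsProbabilityMeasure P] [IsProbabilityMeasure Q] (hP : ∀ᵐ w ∂P, w ∈ stateSpace 𝓜)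
    (hQ : ∀ᵐ w ∂Q, w ∈ stateSpace 𝓜) (h : ∀ s, ∫ w, moment w s ∂P = ∫ w, moment w s ∂Q) :
    P = Q := by
  have hK := isCompact_stateSpace h𝓜
  have hKm : MeasurableSet (stateSpace 𝓜) := by
    have : T2Space (Matrix ι ι ℂ) := inferInstanceAs (T2Space (ι → ι → ℂ))
    exact hK.isClosed.measurableSet
  have : CompactSpace (stateSpace 𝓜) := isCompact_iff_compactSpace.1 hK
  have : PolishSpace (Matrix ι ι ℂ) := inferInstanceAs (PolishSpace (ι → ι → ℂ))
  have : PolishSpace (stateSpace 𝓜) := hK.isClosed.polishSpace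
  let F : Multiset (ι × ι) → BoundedContinuousFunction (stateSpace 𝓜) ℂ := fun s =>
    BoundedContinuousFunction.mkOfCompact
      ⟨fun w => moment w.1 s, (continuous_moment s).comp continuous_subtype_val⟩
  let A : Submodule ℂ (BoundedContinuousFunction (stateSpace 𝓜) ℂ) :=
    Submodule.span ℂ (Set.range F)
  have hstar : ∀ s, star (F s) = F (s.map Prod.swap) := by
    intro s
    ext w
    change star (moment w.1 s) = moment w.1 (s.map Prod.swap)
    induction s using Multiset.induction_on with
    | empty => simp
    | cons p s ih =>
      rw [Multiset.map_cons, moment_cons, moment_cons, star_mul', ih]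
      congr 1
      exact w.2.1.1.apply _ _
  have hmul : ∀ s t, F s * F t = F (s + t) := by
    intro s t
    ext w
    change moment w.1 s * moment w.1 t = moment w.1 (s + t)
    simp [moment]
  let B : StarSubalgebra ℂ (BoundedContinuousFunction (stateSpace 𝓜) ℂ) :=
    { carrier := A
      mul_mem' := by
        intro f g hf hg
        induction hf, hg using Submodule.span_induction₂ with
        | mem_mem f g hf hg =>
          obtain ⟨s, rfl⟩ := hf
          obtain ⟨t, rfl⟩ := hg
          rw [hmul]
          exact Submodule.subset_span ⟨_, rfl⟩
        | zero_left g _ => simp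
        | zero_right f _ => simp
        | add_left f g k _ _ _ h1 h2 => rw [add_mul]; exact A.add_mem h1 h2
        | add_right f g k _ _ _ h1 h2 => rw [mul_add]; exact A.add_mem h1 h2
        | smul_left r f g _ _ h => rw [smul_mul_assoc]; exact A.smul_mem r h
        | smul_right r f g _ _ h => rw [mul_smul_comm]; exact A.smul_mem r h
      one_mem' := Submodule.subset_span ⟨0, by ext w; exact moment_zero w.1⟩
      add_mem' := A.add_mem
      zero_mem' := A.zero_mem
      algebraMap_mem' := fun r => by
        rw [Algebra.algebraMap_eq_smul_one]
        exact A.smul_mem r (Submodule.subset_span ⟨0, by ext w; exact moment_zero w.1⟩)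
      star_mem' := by
        intro f hf
        induction hf using Submodule.span_induction with
        | mem f hf =>
          obtain ⟨s, rfl⟩ := hf
          exact Submodule.subset_span ⟨_, (hstar s).symm⟩
        | zero => simp
        | add f g _ _ h1 h2 => rw [star_add]; exact A.add_mem h1 h2
        | smul r f _ h => rw [star_smul]; exact A.smul_mem _ h }
  have hint : ∀ μ : Measure (Matrix ι ι ℂ), (∀ᵐ w ∂μ, w ∈ stateSpace 𝓜) → ∀ s,
      ∫ w, F s w ∂(μ.comap (Subtype.val : stateSpace 𝓜 → _)) = ∫ w, moment w s ∂μ := by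
    intro μ hμ s
    change ∫ w : stateSpace 𝓜, moment w.1 s ∂(μ.comap Subtype.val) = _
    rw [integral_subtype_comap hKm (fun w => moment w s), Measure.restrict_eq_self_of_ae_mem hμ]
  have hcomap : P.comap (Subtype.val : stateSpace 𝓜 → _) = Q.comap Subtype.val := by
    have hf : ∀ μ : Measure (Matrix ι ι ℂ), IsFiniteMeasure μ →
        IsFiniteMeasure (μ.comap (Subtype.val : stateSpace 𝓜 → _)) := fun μ _ => ⟨by
      rw [(MeasurableEmbedding.subtype_coe hKm).comap_apply]
      exact measure_lt_top _ _⟩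
    have := hf P inferInstance
    have := hf Q inferInstance
    refine ext_of_forall_mem_subalgebra_integral_eq_of_polish (A := B) ?_ ?_
    · intro v w hvw
      have : ∃ a b, v.1 a b ≠ w.1 a b := by
        by_contra! hc
        exact hvw (Subtype.ext (Matrix.ext hc))
      obtain ⟨a, b, hab⟩ := this
      refine ⟨_, ⟨_, ⟨F {(a, b)}, Submodule.subset_span ⟨_, rfl⟩, rfl⟩, rfl⟩, ?_⟩
      change moment v.1 {(a, b)} ≠ moment w.1 {(a, b)}
      simpa [moment] using hab
    · intro g hg
      change g ∈ Submodule.span ℂ (Set.range F) at hg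
      induction hg using Submodule.span_induction with
      | mem g hg =>
        obtain ⟨s, rfl⟩ := hg
        rw [hint P hP, hint Q hQ, h]
      | zero => simp
      | add f g _ _ h1 h2 =>
        simp only [BoundedContinuousFunction.coe_add, Pi.add_apply]
        rw [integral_add (f.integrable _) (g.integrable _),
          integral_add (f.integrable _) (g.integrable _), h1, h2]
      | smul r f _ h =>
        simp only [BoundedContinuousFunction.coe_smul]
        rw [integral_smul, integral_smul, h]
  rw [← Measure.restrict_eq_self_of_ae_mem hP, ← Measure.restrict_eq_self_of_ae_mem hQ,
    ← map_comap_subtype_coe hKm, ← map_comap_subtype_coe hKm, hcomap]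

end Mixture

/-! ### Linear constraints pass to almost every state. -/

section Constraint

/-- `G` may be uncountable, but a finite basis of its span produces one null set for all of `G`. -/
theorem ae_forall_eq_zero_of_forall_ae {E : Type*} [AddCommGroup E] [Module ℂ E]
    [FiniteDimensional ℂ E] [MeasurableSpace E] {P : Measure E} (G : Set (Module.Dual ℂ E))
    (h : ∀ g ∈ G, ∀ᵐ w ∂P, g w = 0) : ∀ᵐ w ∂P, ∀ g ∈ G, g w = 0 := by
  obtain ⟨b, hbG, hspan, hli⟩ := exists_linearIndependent ℂ G
  have hb : b.Finite := hli.setFinite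
  filter_upwards [(ae_ball_iff hb.countable).2 fun g hg => h g (hbG hg)] with w hw g hg
  have hg' : g ∈ Submodule.span ℂ b := by rw [hspan]; exact Submodule.subset_span hg
  clear hg
  induction hg' using Submodule.span_induction with
  | mem g hgb => exact hw g hgb
  | zero => rfl
  | add f g _ _ h1 h2 => rw [LinearMap.add_apply, h1, h2, add_zero]
  | smul c f _ h => rw [LinearMap.smul_apply, h, smul_zero]

theorem ae_eq_zero_of_integral_mul_star {α : Type*} [MeasurableSpace α]
    {P : Measure α} {f : α → ℂ}
    (hf : Integrable (fun w => f w * star (f w)) P) (h : ∫ w, f w * star (f w) ∂P = 0) :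
    ∀ᵐ w ∂P, f w = 0 := by
  have h1 : (fun w => f w * star (f w)) = fun w => ((‖f w‖ ^ 2 : ℝ) : ℂ) := by
    ext w
    rw [Complex.star_def, Complex.mul_conj']
    norm_cast
  rw [h1] at hf h
  rw [integral_complex_ofReal] at h
  have h2 : ∫ w, ‖f w‖ ^ 2 ∂P = 0 := by exact_mod_cast h
  have h3 : Integrable (fun w => ‖f w‖ ^ 2) P := hf.re
  rw [integral_eq_zero_iff_of_nonneg (fun w => by positivity) h3] at h2
  filter_upwards [h2] with w hw
  simpa using hw

variable {ι : Type*} [Fintype ι] [DecidableEq ι]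

theorem integrable_of_continuous {𝓜 : Set (Matrix ι ι ℂ)} {δ : ℝ}
    (h𝓜 : (δ : ℂ) • (1 : Matrix ι ι ℂ) ∈ 𝓜) {P : Measure (Matrix ι ι ℂ)}
    [IsFiniteMeasure P] (hP : ∀ᵐ w ∂P, w ∈ stateSpace 𝓜) {f : Matrix ι ι ℂ → ℂ}
    (hf : Continuous f) : Integrable f P := by
  obtain ⟨C, hC⟩ := (isCompact_stateSpace h𝓜).exists_bound_of_continuousOn hf.continuousOn
  have : SecondCountableTopology (Matrix ι ι ℂ) :=
    inferInstanceAs (SecondCountableTopology (ι → ι → ℂ))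
  refine Integrable.of_bound hf.aestronglyMeasurable C ?_
  filter_upwards [hP] with w hw using hC w hw

theorem dual_apply_eq_sum (g : Module.Dual ℂ (Matrix ι ι ℂ)) (w : Matrix ι ι ℂ) :
    g w = ∑ a, ∑ b, g (Matrix.single a b 1) * w a b := by
  conv_lhs => rw [Matrix.matrix_eq_sum_single w]
  simp only [map_sum]
  refine Finset.sum_congr rfl fun a _ => Finset.sum_congr rfl fun b _ => ?_
  have : Matrix.single a b (w a b) = w a b • Matrix.single a b (1 : ℂ) := by simp
  rw [this, map_smul, smul_eq_mul, mul_comm]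

theorem continuous_dual (g : Module.Dual ℂ (Matrix ι ι ℂ)) : Continuous g := by
  have : (g : Matrix ι ι ℂ → ℂ) = fun w => ∑ a, ∑ b, g (Matrix.single a b 1) * w a b :=
    funext fun w => dual_apply_eq_sum g w
  rw [this]
  fun_prop

theorem ae_dual_eq_zero {𝓜 : Set (Matrix ι ι ℂ)} {δ : ℝ}
    (h𝓜 : (δ : ℂ) • (1 : Matrix ι ι ℂ) ∈ 𝓜) {P : Measure (Matrix ι ι ℂ)}
    [IsProbabilityMeasure P] (hP : ∀ᵐ w ∂P, w ∈ stateSpace 𝓜)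
    (g : Module.Dual ℂ (Matrix ι ι ℂ)) {m : ℕ}
    (h : ∀ s : Multiset (ι × ι), s.card = m + 1 → ∫ w, g w * moment w s ∂P = 0) :
    ∀ᵐ w ∂P, g w = 0 := by
  have hint : ∀ s, Integrable (fun w => g w * moment w s) P := fun s =>
    integrable_of_continuous h𝓜 hP ((continuous_dual g).mul (continuous_moment s))
  induction m with
  | succ m ih =>
    refine ih fun s hs => ?_
    -- Multiplying by `δ * w.trace = 1` inserts a trial, so surplus trials can be traced out until
    -- one copy is left.
    have h1 : ∀ᵐ w ∂P, g w * moment w s = ∑ a, (δ : ℂ) * (g w * moment w ((a, a) ::ₘ s)) := by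
      filter_upwards [hP] with w hw
      have htr := hw.2 _ h𝓜
      rw [Matrix.smul_mul, one_mul, Matrix.trace_smul, smul_eq_mul] at htr
      calc g w * moment w s = (δ * w.trace) * (g w * moment w s) := by rw [htr, one_mul]
        _ = _ := by
          simp only [Matrix.trace, Matrix.diag_apply, Finset.mul_sum, Finset.sum_mul, moment_cons]
          exact Finset.sum_congr rfl fun a _ => by ring
    rw [integral_congr_ae h1, integral_finsetSum _ fun a _ => (hint _).const_mul _]
    refine Finset.sum_eq_zero fun a _ => ?_
    rw [integral_const_mul, h _ (by simp [hs]), mul_zero]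
  | zero =>
    refine ae_eq_zero_of_integral_mul_star (integrable_of_continuous h𝓜 hP
      ((continuous_dual g).mul (continuous_dual g).star)) ?_
    -- Hermiticity turns the conjugate of `w a b` into `w b a`, so the remaining copy supplies `star
    -- (g w)`.
    have h1 : ∀ᵐ w ∂P, g w * star (g w) = ∑ a, ∑ b,
        star (g (Matrix.single a b 1)) * (g w * moment w {(b, a)}) := by
      filter_upwards [hP] with w hw
      conv_lhs => enter [2]; rw [dual_apply_eq_sum g w]
      simp only [star_sum, Finset.mul_sum]
      refine Finset.sum_congr rfl fun a _ => Finset.sum_congr rfl fun b _ => ?_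
      rw [star_mul', hw.1.1.apply]
      simp only [moment, Multiset.map_singleton, Multiset.prod_singleton]
      ring
    rw [integral_congr_ae h1, integral_finsetSum _ fun a _ =>
      integrable_finsetSum _ fun b _ => (hint _).const_mul _]
    refine Finset.sum_eq_zero fun a _ => ?_
    rw [integral_finsetSum _ fun b _ => (hint _).const_mul _]
    refine Finset.sum_eq_zero fun b _ => ?_
    rw [integral_const_mul, h _ (by simp), mul_zero]

theorem ae_mem_of_trialBlock_mem {𝓜 : Set (Matrix ι ι ℂ)} {δ : ℝ}
    (h𝓜 : (δ : ℂ) • (1 : Matrix ι ι ℂ) ∈ 𝓜) {P : Measure (Matrix ι ι ℂ)}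
    [IsProbabilityMeasure P] (hP : ∀ᵐ w ∂P, w ∈ stateSpace 𝓜)
    {m : ℕ} {Y : Matrix (Fin (m + 2) → ι) (Fin (m + 2) → ι) ℂ}
    (hY : ∀ x y, Y x y = ∫ w, ∏ i, w (x i) (y i) ∂P)
    (T : Submodule ℂ (Matrix ι ι ℂ)) (hT : ∀ x y, trialBlock 0 Y x y ∈ T) :
    ∀ᵐ w ∂P, w ∈ T := by
  have := ae_forall_eq_zero_of_forall_ae (P := P)
    {g : Module.Dual ℂ (Matrix ι ι ℂ) | ∀ t ∈ T, g t = 0} fun g hg => by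
      refine ae_dual_eq_zero h𝓜 hP g (m := m) fun s hs => ?_
      obtain ⟨x, y, hxy⟩ : ∃ x y : Fin (m + 1) → ι, s = pairs x y := hs ▸ exists_pairs s
      rcases isEmpty_or_nonempty ι with hι | ⟨⟨c⟩⟩
      · exact (hι.elim (x 0))
      have h0 := hg _ (hT (Fin.cons c x) (Fin.cons c y))
      rw [dual_apply_eq_sum] at h0
      have hint : ∀ a b, Integrable (fun w : Matrix ι ι ℂ =>
          g (Matrix.single a b 1) * (w a b * moment w s)) P := fun a b =>
        integrable_of_continuous h𝓜 hP (continuous_const.mul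
          ((by fun_prop : Continuous fun w : Matrix ι ι ℂ => w a b).mul (continuous_moment s)))
      have h1 : ∀ w : Matrix ι ι ℂ, g w * moment w s =
          ∑ a, ∑ b, g (Matrix.single a b 1) * (w a b * moment w s) := by
        intro w
        conv_lhs => rw [dual_apply_eq_sum g w]
        simp only [Finset.sum_mul, mul_assoc]
      simp only [h1]
      rw [integral_finsetSum _ fun a _ => integrable_finsetSum _ fun b _ => hint a b, ← h0]
      refine Finset.sum_congr rfl fun a _ => ?_
      rw [integral_finsetSum _ fun b _ => hint a b]
      refine Finset.sum_congr rfl fun b _ => ?_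
      rw [integral_const_mul, trialBlock, Matrix.of_apply, Fin.update_cons_zero,
        Fin.update_cons_zero, hY]
      simp [Fin.prod_univ_succ, hxy, moment_pairs]
  filter_upwards [this] with w hw
  exact (Subspace.forall_mem_dualAnnihilator_apply_eq_zero_iff T w).1 fun g hg =>
    hw g ((Submodule.mem_dualAnnihilator g).1 hg)

end Constraint

/-! ### From symmetric sequences of operators to functions of multisets. -/

section Encoding

variable {ι : Type*}

open scoped Classical in
/-- The function of multisets of matrix positions that encodes a sequence of symmetric operators. -/
def ofTrials (W : ∀ n : ℕ, Matrix (Fin n → ι) (Fin n → ι) ℂ) (s : Multiset (ι × ι)) : ℂ :=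
  if s = 0 then 1 else W s.toList.length (fun i => s.toList[i].1) (fun i => s.toList[i].2)

/-- Allowing `m` and `n` to be different terms avoids casts when the length of a list is only
propositionally equal to `n`. -/
theorem apply_comp_equiv {W : ∀ n : ℕ, Matrix (Fin n → ι) (Fin n → ι) ℂ}
    (hW : ∀ n, 1 ≤ n → ∀ σ : Equiv.Perm (Fin n), permuteTrials σ (W n) = W n) {m n : ℕ}
    (hn : 1 ≤ n) (e : Fin m ≃ Fin n) (x y : Fin n → ι) : W m (x ∘ e) (y ∘ e) = W n x y := by
  obtain rfl : m = n := by simpa using Fintype.card_congr e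
  conv_rhs => rw [← hW m hn e.symm]
  rfl

theorem ofTrials_zero (W : ∀ n : ℕ, Matrix (Fin n → ι) (Fin n → ι) ℂ) : ofTrials W 0 = 1 := by
  simp [ofTrials]

/-- The list chosen by `toList` is a permutation of the given enumeration, and permutations of the
trials do not change `W n`. -/
theorem ofTrials_pairs {W : ∀ n : ℕ, Matrix (Fin n → ι) (Fin n → ι) ℂ}
    (hW : ∀ n, 1 ≤ n → ∀ σ : Equiv.Perm (Fin n), permuteTrials σ (W n) = W n) {n : ℕ}
    (hn : 1 ≤ n) (x y : Fin n → ι) : ofTrials W (pairs x y) = W n x y := by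
  classical
  have hne : pairs x y ≠ 0 := by
    intro h
    have := congrArg Multiset.card h
    simp [pairs] at this
    omega
  have hperm : (pairs x y).toList.Perm (List.ofFn fun i => (x i, y i)) := by
    rw [← Multiset.coe_eq_coe, Multiset.coe_toList, pairs]
  let e : Fin (pairs x y).toList.length ≃ Fin n :=
    (Equiv.ofBijective _ ⟨hperm.idxBij_injective, hperm.idxBij_surjective⟩).trans
      (finCongr (by simp))
  have he : ∀ i, (x (e i), y (e i)) = (pairs x y).toList[i] := by
    intro i
    have := hperm.getElem_idxBij_eq_getElem i
    rw [List.getElem_ofFn] at this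
    exact this
  rw [ofTrials, if_neg hne, ← apply_comp_equiv hW hn e x y]
  congr 1
  · ext i; exact (congrArg Prod.fst (he i)).symm
  · ext i; exact (congrArg Prod.snd (he i)).symm

theorem pairs_snoc {n : ℕ} (x y : Fin n → ι) (a b : ι) :
    pairs (Fin.snoc (α := fun _ => ι) x a) (Fin.snoc (α := fun _ => ι) y b) =
      (a, b) ::ₘ pairs x y := by
  rw [pairs, List.ofFn_succ']
  simp [pairs, Multiset.cons_coe]

theorem traceLastTrial_mul_onLastTrial [Fintype ι] [DecidableEq ι] {n : ℕ}
    (X : Matrix (Fin (n + 1) → ι) (Fin (n + 1) → ι) ℂ) (M : Matrix ι ι ℂ) (x y : Fin n → ι) :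
    traceLastTrial (X * onLastTrial n M) x y = ∑ a, ∑ b, M b a *
      X (Fin.snoc (α := fun _ => ι) x a) (Fin.snoc (α := fun _ => ι) y b) := by
  have hsum : ∀ f : (Fin (n + 1) → ι) → ℂ,
      ∑ z, f z = ∑ b, ∑ z : Fin n → ι, f (Fin.snoc (α := fun _ => ι) z b) := by
    intro f
    rw [← (Fin.snocEquiv fun _ : Fin (n + 1) => ι).sum_comp, Fintype.sum_prod_type]
    rfl
  simp only [traceLastTrial, Matrix.of_apply, Matrix.mul_apply, onLastTrial, hsum, Fin.init_snoc,
    Fin.snoc_last, Matrix.one_apply, ite_mul, one_mul, zero_mul, mul_ite, mul_zero,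
    Finset.sum_ite_eq', Finset.mem_univ, if_true]
  exact Finset.sum_congr rfl fun a _ => Finset.sum_congr rfl fun b _ => mul_comm _ _

end Encoding

/-! ### Process matrices as states; the de Finetti representation. -/

section Sites

variable {S : Type*} {I O : S → Type*}

/-- Basis labels of `n` trials, regarded as basis labels of a scenario with sites `Fin n × S`. -/
def trialsEquiv (I O : S → Type*) (n : ℕ) :
    (Fin n → Idx I O) ≃ Idx (fun p : Fin n × S => I p.2) (fun p : Fin n × S => O p.2) where
  toFun x p := x p.1 p.2
  invFun z j s := z (j, s)
  left_inv _ := rfl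
  right_inv _ := rfl

theorem asOneShot_apply {n : ℕ} (X : Matrix (Fin n → Idx I O) (Fin n → Idx I O) ℂ)
    (x y : Fin n → Idx I O) : asOneShot X (trialsEquiv I O n x) (trialsEquiv I O n y) = X x y := rfl

variable [Fintype S]

theorem siteTensor_trialsEquiv {n : ℕ}
    (M : LocalOps (fun p : Fin n × S => I p.2) (fun p : Fin n × S => O p.2))
    (x y : Fin n → Idx I O) :
    siteTensor M (trialsEquiv I O n x) (trialsEquiv I O n y) =
      ∏ j, siteTensor (I := I) (O := O) (fun s => M (j, s)) (x j) (y j) := by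
  simp only [siteTensor, Matrix.of_apply, Fintype.prod_prod_type]
  rfl

variable [DecidableEq S] [∀ s, Fintype (I s)] [∀ s, Fintype (O s)]
  [∀ s, DecidableEq (I s)] [∀ s, DecidableEq (O s)]

variable (I O) in
/-- Tensor products of CPTP maps at the sites. -/
def cptpTensors : Set (Op I O) := {A | ∃ M : LocalOps I O, (∀ s, IsCPTP (M s)) ∧ A = siteTensor M}

theorem mem_stateSpace_iff (w : Op I O) : w ∈ stateSpace (cptpTensors I O) ↔ IsProcessMatrix w := by
  constructor
  · exact fun h => ⟨h.1, fun M hM => h.2 _ ⟨M, hM, rfl⟩⟩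
  · rintro h
    refine ⟨h.1, ?_⟩
    rintro _ ⟨M, hM, rfl⟩
    exact h.2 M hM

theorem isCPTP_depolarizing (a b : Type*) [Fintype b] [Nonempty b] [DecidableEq a]
    [DecidableEq b] :
    IsCPTP (((Fintype.card b : ℝ)⁻¹ : ℂ) • (1 : Matrix (a × b) (a × b) ℂ)) := by
  constructor
  · refine Matrix.PosSemidef.one.smul ?_
    exact_mod_cast (by positivity : (0 : ℝ) ≤ (Fintype.card b : ℝ)⁻¹)
  · ext i i'
    by_cases h : i = i'
    · subst h
      simp
    · simp [Matrix.one_apply, h]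

variable (O) in
/-- The inverse of the dimension of all output spaces. -/
def outputWeight : ℝ := ∏ s, (Fintype.card (O s) : ℝ)⁻¹

/-- Depolarizing at every site gives the multiple of the identity on which all compactness bounds
rest. -/
theorem smul_one_mem_cptpTensors [∀ s, Nonempty (O s)] :
    ((outputWeight O : ℝ) : ℂ) • (1 : Op I O) ∈ cptpTensors I O := by
  refine ⟨fun s => ((Fintype.card (O s) : ℝ)⁻¹ : ℂ) • 1, fun s => isCPTP_depolarizing _ _, ?_⟩
  ext x y
  simp only [siteTensor, Matrix.of_apply, Matrix.smul_apply, smul_eq_mul, Finset.prod_mul_distrib,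
    outputWeight, Matrix.one_apply, Complex.ofReal_prod, Complex.ofReal_inv]
  congr 1
  rw [Finset.prod_ite_zero]
  simp [funext_iff]

theorem outputWeight_pos [∀ s, Nonempty (O s)] : 0 < outputWeight O :=
  Finset.prod_pos fun s _ => by positivity

theorem IsExchangeable.ofTrials_mem {W : ∀ n : ℕ, Matrix (Fin n → Idx I O) (Fin n → Idx I O) ℂ}
    (hW : IsExchangeable W) : ofTrials W ∈ consistentBase (cptpTensors I O) := by
  have hlevel : ∀ n, 1 ≤ n → level (ofTrials W) n = W n := fun n hn => by
    ext x y; exact ofTrials_pairs hW.symmetric hn x y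
  refine ⟨⟨fun n => ?_, ?_⟩, ofTrials_zero W⟩
  · rcases Nat.eq_zero_or_pos n with rfl | hn
    · have : level (ofTrials W) 0 = 1 := by
        ext x y
        rw [Subsingleton.elim x y]
        simp [level, ofTrials_zero]
      rw [this]
      exact Matrix.PosSemidef.one
    · rw [hlevel n hn]
      exact (hW.process n hn).1.submatrix (trialsEquiv I O n)
  · rintro _ ⟨M, hM, rfl⟩
    ext s
    rcases eq_or_ne s 0 with rfl | hs
    -- Extendibility starts at `n = 1`; at the empty multiset its role is taken by the normalization
    -- of `W 1`.
    · have h1 := (hW.process 1 le_rfl).2 (fun p => M p.2) fun p => hM p.2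
      rw [ofTrials_zero, ← h1, contract_apply, Matrix.trace, Finset.sum_comm,
        ← (trialsEquiv I O 1).sum_comp, ← (Equiv.funUnique (Fin 1) (Idx I O)).symm.sum_comp]
      refine Finset.sum_congr rfl fun b _ => ?_
      rw [Matrix.diag_apply, Matrix.mul_apply, ← (trialsEquiv I O 1).sum_comp,
        ← (Equiv.funUnique (Fin 1) (Idx I O)).symm.sum_comp]
      refine Finset.sum_congr rfl fun a _ => ?_
      rw [siteTensor_trialsEquiv, asOneShot_apply, ← ofTrials_pairs hW.symmetric le_rfl]
      simp [pairs]
    · obtain ⟨x, y, hxy⟩ := exists_pairs s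
      have hn : 1 ≤ s.card := Multiset.card_pos.2 hs
      generalize s.card = n at x y hxy hn
      subst hxy
      rw [ofTrials_pairs hW.symmetric hn, hW.extendible n hn M hM,
        traceLastTrial_mul_onLastTrial, contract_apply]
      refine Finset.sum_congr rfl fun a _ => Finset.sum_congr rfl fun b _ => ?_
      rw [← ofTrials_pairs hW.symmetric (by omega), pairs_snoc]

theorem IsDeFinettiMeasure.ae_mem {W : ∀ n : ℕ, Matrix (Fin n → Idx I O) (Fin n → Idx I O) ℂ}
    {P : Measure (Op I O)} (hP : IsDeFinettiMeasure W P) :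
    ∀ᵐ w ∂P, w ∈ stateSpace (cptpTensors I O) := by
  simpa only [mem_stateSpace_iff] using hP.process

theorem IsExchangeable.exists_unique [∀ s, Nonempty (O s)]
    {W : ∀ n : ℕ, Matrix (Fin n → Idx I O) (Fin n → Idx I O) ℂ} (hW : IsExchangeable W) :
    ∃ P, IsDeFinettiMeasure W P ∧ ∀ Q, IsDeFinettiMeasure W Q → Q = P := by
  obtain ⟨P, hP, hPs, hPm⟩ := exists_probabilityMeasure_moment outputWeight_pos
    smul_one_mem_cptpTensors hW.ofTrials_mem
  have hPd : IsDeFinettiMeasure W P := by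
    refine ⟨hP, by simpa only [mem_stateSpace_iff] using hPs, fun n hn x y => ?_⟩
    rw [← ofTrials_pairs hW.symmetric hn, hPm]
    simp only [moment_pairs]
  refine ⟨P, hPd, fun Q hQ => ?_⟩
  have := hQ.prob
  refine measure_ext_of_moment smul_one_mem_cptpTensors hQ.ae_mem hPs fun s => ?_
  rcases eq_or_ne s 0 with rfl | hs
  · simp
  · obtain ⟨x, y, hxy⟩ := exists_pairs s
    have hn : 1 ≤ s.card := Multiset.card_pos.2 hs
    generalize s.card = n at x y hxy hn
    subst hxy
    simp only [moment_pairs]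
    rw [← hQ.mixture n hn, ← hPd.mixture n hn]

theorem IsExchangeable.hasUniqueDeFinetti [∀ s, Nonempty (O s)]
    {W : ∀ n : ℕ, Matrix (Fin n → Idx I O) (Fin n → Idx I O) ℂ} (hW : IsExchangeable W)
    {C : Set (Op I O)} (hC : ∀ P, IsDeFinettiMeasure W P → ∀ᵐ w ∂P, w ∈ C) :
    HasUniqueDeFinetti W C := by
  obtain ⟨P, hP, hPu⟩ := hW.exists_unique
  exact ⟨P, hP, hC P hP, hPu⟩

theorem IsDeFinettiMeasure.ae_mem_submodule [∀ s, Nonempty (O s)]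
    {W : ∀ n : ℕ, Matrix (Fin n → Idx I O) (Fin n → Idx I O) ℂ} {P : Measure (Op I O)}
    (hP : IsDeFinettiMeasure W P) {N : ℕ} (hN : 2 ≤ N) (T : Submodule ℂ (Op I O))
    (hT : ∀ j x y, trialBlock j (W N) x y ∈ T) : ∀ᵐ w ∂P, w ∈ T := by
  obtain ⟨m, rfl⟩ := Nat.exists_eq_add_of_le' hN
  have := hP.prob
  exact ae_mem_of_trialBlock_mem smul_one_mem_cptpTensors hP.ae_mem
    (hP.mixture (m + 2) (by omega)) T (hT 0)

/-- The operators whose real and imaginary parts lie in a real subspace. -/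
def complexSpan {ι : Type*} [Fintype ι] [DecidableEq ι]
    (U : Submodule ℝ (selfAdjoint (Matrix ι ι ℂ))) : Submodule ℂ (Matrix ι ι ℂ) where
  carrier := {A | realPart A ∈ U ∧ imaginaryPart A ∈ U}
  add_mem' hA hB := by
    simp only [Set.mem_ofPred_eq, map_add] at *
    exact ⟨U.add_mem hA.1 hB.1, U.add_mem hA.2 hB.2⟩
  zero_mem' := by simp
  smul_mem' c A hA := by
    simp only [Set.mem_ofPred_eq, realPart_smul, imaginaryPart_smul] at *
    exact ⟨U.sub_mem (U.smul_mem _ hA.1) (U.smul_mem _ hA.2),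
      U.add_mem (U.smul_mem _ hA.2) (U.smul_mem _ hA.1)⟩

end Sites

/-! ### Reduced operators as traces against product operators. -/

section Reduced

variable {S : Type*} {I O : S → Type*} [Fintype S] [DecidableEq S]
  [∀ s, Fintype (I s)] [∀ s, Fintype (O s)] [∀ s, DecidableEq (I s)] [∀ s, DecidableEq (O s)]

/-- Combines basis labels on `K` and on its complement. -/
def glue (K : Finset S) (x : ∀ s : {s // s ∈ K}, I s × O s) (u : ∀ s : {s // s ∉ K}, I s × O s) :
    Idx I O :=
  (Equiv.piEquivPiSubtypeProd (· ∈ K) fun s => I s × O s).symm (x, u)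

theorem sum_glue (K : Finset S) (f : Idx I O → ℂ) :
    ∑ z, f z = ∑ x, ∑ u, f (glue K x u) := by
  rw [← (Equiv.piEquivPiSubtypeProd (· ∈ K) fun s => I s × O s).symm.sum_comp,
    Fintype.sum_prod_type]
  rfl

theorem siteTensor_glue (K : Finset S) (N : LocalOps I O)
    (x y : ∀ s : {s // s ∈ K}, I s × O s) (u v : ∀ s : {s // s ∉ K}, I s × O s) :
    siteTensor N (glue K x u) (glue K y v) =
      (∏ s : {s // s ∈ K}, N s (x s) (y s)) * ∏ s : {s // s ∉ K}, N s (u s) (v s) := by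
  have h1 : (∏ s : {s // s ∈ K}, N s (x s) (y s)) =
      ∏ s : {s // s ∈ K}, N s (glue K x u s) (glue K y v s) :=
    Finset.prod_congr rfl fun s _ => by simp [glue, s.2]
  have h2 : (∏ s : {s // s ∉ K}, N s (u s) (v s)) =
      ∏ s : {s // s ∉ K}, N s (glue K x u s) (glue K y v s) :=
    Finset.prod_congr rfl fun s _ => by simp [glue, s.2]
  rw [h1, h2, siteTensor, Matrix.of_apply, ← Fintype.prod_subtype_mul_prod_subtype (· ∈ K)]
  congr!

theorem reduced_apply (K : Finset S) (M : LocalOps I O) (W : Op I O)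
    (x y : ∀ s : {s // s ∈ K}, I s × O s) :
    reduced K M W x y = ∑ u : ∀ s : {s // s ∉ K}, I s × O s, ∑ v : ∀ s : {s // s ∉ K}, I s × O s,
      (∏ s : {s // s ∉ K}, M s (u s) (v s)) * W (glue K x v) (glue K y u) := by
  change ∑ u, (siteTensor (fun s => if s ∈ K then 1 else M s) * W) (glue K x u) (glue K y u) = _
  refine Finset.sum_congr rfl fun u _ => ?_
  rw [Matrix.mul_apply, sum_glue K, Finset.sum_eq_single x]
  · refine Finset.sum_congr rfl fun v _ => ?_
    rw [siteTensor_glue]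
    congr 1
    rw [Finset.prod_eq_one, one_mul]
    · exact Finset.prod_congr rfl fun s _ => by rw [if_neg s.2]
    · intro s _; rw [if_pos s.2, Matrix.one_apply_eq]
  · intro z _ hz
    refine Finset.sum_eq_zero fun v _ => ?_
    obtain ⟨s, hs⟩ := Function.ne_iff.1 hz
    rw [siteTensor_glue, Finset.prod_eq_zero (Finset.mem_univ s), zero_mul, zero_mul]
    rw [if_pos s.2, Matrix.one_apply_ne' hs]
  · simp

theorem trace_siteTensor_mul (K : Finset S) (N : LocalOps I O) (W : Op I O) :
    (siteTensor N * W).trace = ∑ x, ∑ y, (∏ s : {s // s ∈ K}, N s (x s) (y s)) *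
      reduced K N W y x := by
  simp only [Matrix.trace, Matrix.diag_apply, Matrix.mul_apply, reduced_apply, sum_glue K,
    siteTensor_glue, Finset.mul_sum]
  refine Finset.sum_congr rfl fun x _ => ?_
  rw [Finset.sum_comm]
  refine Finset.sum_congr rfl fun y _ => Finset.sum_congr rfl fun u _ =>
    Finset.sum_congr rfl fun v _ => ?_
  ring

theorem reduced_congr {K : Finset S} {M N : LocalOps I O} (h : ∀ s, s ∉ K → M s = N s)
    (W : Op I O) : reduced K M W = reduced K N W := by
  ext x y
  simp only [reduced_apply]
  refine Finset.sum_congr rfl fun u _ => Finset.sum_congr rfl fun v _ => ?_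
  congr 1
  exact Finset.prod_congr rfl fun s _ => by rw [h s s.2]

/-- The matrix units given by `x` and `y` at the sites in `K`, and `M` elsewhere. -/
def unitsOn (K : Finset S) (x y : ∀ s : {s // s ∈ K}, I s × O s) (M : LocalOps I O) :
    LocalOps I O := fun s => if h : s ∈ K then Matrix.single (x ⟨s, h⟩) (y ⟨s, h⟩) 1 else M s

theorem unitsOn_of_notMem {K : Finset S} (x y : ∀ s : {s // s ∈ K}, I s × O s)
    (M : LocalOps I O) {s : S} (hs : s ∉ K) : unitsOn K x y M s = M s := by
  simp [unitsOn, hs]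

theorem unitsOn_of_mem {K : Finset S} (x y : ∀ s : {s // s ∈ K}, I s × O s)
    (M : LocalOps I O) {s : S} (hs : s ∈ K) :
    unitsOn K x y M s = Matrix.single (x ⟨s, hs⟩) (y ⟨s, hs⟩) 1 := by
  simp [unitsOn, hs]

/-- Matrix units on `K` pick out one entry; the trace pairing interchanges `x` and `y`. In this form
entries factorize over trials. -/
theorem reduced_apply_eq_trace (K : Finset S) (M : LocalOps I O) (W : Op I O)
    (x y : ∀ s : {s // s ∈ K}, I s × O s) :
    reduced K M W x y = (siteTensor (unitsOn K y x M) * W).trace := by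
  have hprod : ∀ x' y' : ∀ s : {s // s ∈ K}, I s × O s,
      (∏ s : {s // s ∈ K}, unitsOn K y x M s (x' s) (y' s)) =
        if x' = y ∧ y' = x then 1 else 0 := by
    intro x' y'
    have : ∀ s : {s // s ∈ K}, unitsOn K y x M s (x' s) (y' s) =
        if x' s = y s ∧ y' s = x s then 1 else 0 := by
      intro s
      rw [unitsOn_of_mem _ _ _ s.2, Matrix.single, Matrix.of_apply]
      exact if_congr (and_congr eq_comm eq_comm) rfl rfl
    simp only [this]
    rw [Finset.prod_ite_zero]
    simp [funext_iff, forall_and]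
  rw [trace_siteTensor_mul K, Finset.sum_eq_single y, Finset.sum_eq_single x, hprod,
    if_pos ⟨rfl, rfl⟩, one_mul]
  · rw [reduced_congr fun s hs => unitsOn_of_notMem y x M hs]
  · intro z _ hz; rw [hprod, if_neg fun h => hz h.2, zero_mul]
  · simp
  · intro z _ hz
    exact Finset.sum_eq_zero fun v _ => by rw [hprod, if_neg fun h => hz h.1, zero_mul]
  · simp

/-- The conjugate of an entry is again a linear trace functional, so a second trial can evaluate it.
-/
theorem star_trace_unitsOn (K : Finset S) {M : LocalOps I O} (hM : ∀ s, IsCPTP (M s)) {W : Op I O}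
    (hW : W.IsHermitian) (x y : ∀ s : {s // s ∈ K}, I s × O s) :
    star (siteTensor (unitsOn K x y M) * W).trace = (siteTensor (unitsOn K y x M) * W).trace := by
  rw [← Matrix.trace_conjTranspose, Matrix.conjTranspose_mul, hW.eq, Matrix.trace_mul_comm]
  congr 2
  ext a b
  rw [Matrix.conjTranspose_apply, siteTensor, siteTensor, Matrix.of_apply, Matrix.of_apply,
    star_prod]
  refine Finset.prod_congr rfl fun s _ => ?_
  by_cases hs : s ∈ K
  · rw [unitsOn_of_mem _ _ _ hs, unitsOn_of_mem _ _ _ hs, ← Matrix.conjTranspose_apply,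
      Matrix.conjTranspose_single, star_one]
  · rw [unitsOn_of_notMem _ _ _ hs, unitsOn_of_notMem _ _ _ hs]
    exact (hM s).1.1.apply _ _

/-- The trace sees the sites off `K₁` only through the reduced operator. Hence the operators on `K₁`
may be arbitrary, in particular matrix units. -/
theorem trace_eq_of_noSignallingMap_eq_zero {K₁ K₂ : Finset S} {W : Op I O}
    (hW : noSignallingMap K₁ K₂ W = 0) {M M' N N' : LocalOps I O} (hM : ∀ s, IsCPTP (M s))
    (hM' : ∀ s, IsCPTP (M' s)) (hMM' : ∀ s, s ∉ K₂ → M s = M' s)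
    (hN : ∀ s, s ∉ K₁ → N s = M s) (hN' : ∀ s, s ∉ K₁ → N' s = M' s)
    (hNN' : ∀ s ∈ K₁, N s = N' s) :
    (siteTensor N * W).trace = (siteTensor N' * W).trace := by
  have h : reduced K₁ M W = reduced K₁ M' W := by
    have := congrFun hW ⟨(M, M'), hM, hM', hMM'⟩
    exact sub_eq_zero.1 this
  rw [trace_siteTensor_mul K₁, trace_siteTensor_mul K₁, reduced_congr hN, reduced_congr hN', h]
  refine Finset.sum_congr rfl fun x _ => Finset.sum_congr rfl fun y _ => ?_
  congr 1
  exact Finset.prod_congr rfl fun s _ => by rw [hNN' s s.2]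

theorem IsDeFinettiMeasure.trace_asOneShot [∀ s, Nonempty (O s)]
    {W : ∀ n : ℕ, Matrix (Fin n → Idx I O) (Fin n → Idx I O) ℂ} {P : Measure (Op I O)}
    (hP : IsDeFinettiMeasure W P) {n : ℕ} (hn : 1 ≤ n)
    (N : LocalOps (fun p : Fin n × S => I p.2) (fun p : Fin n × S => O p.2)) :
    (siteTensor N * asOneShot (W n)).trace =
      ∫ w, ∏ l, (siteTensor (I := I) (O := O) (fun s => N (l, s)) * w).trace ∂P := by
  have := hP.prob
  have hexp : ∀ w : Op I O, ∏ l, (siteTensor (I := I) (O := O) (fun s => N (l, s)) * w).trace =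
      ∑ x : Fin n → Idx I O, ∑ y : Fin n → Idx I O,
        (∏ l, siteTensor (I := I) (O := O) (fun s => N (l, s)) (x l) (y l)) *
          ∏ l, w (y l) (x l) := by
    intro w
    simp only [Matrix.trace, Matrix.diag_apply, Matrix.mul_apply]
    rw [Finset.prod_univ_sum, Fintype.piFinset_univ]
    refine Finset.sum_congr rfl fun x _ => ?_
    rw [Finset.prod_univ_sum, Fintype.piFinset_univ]
    exact Finset.sum_congr rfl fun y _ => Finset.prod_mul_distrib
  have hint : ∀ (c : ℂ) (x y : Fin n → Idx I O),
      Integrable (fun w : Op I O => c * ∏ l, w (y l) (x l)) P := fun c x y =>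
    integrable_of_continuous smul_one_mem_cptpTensors hP.ae_mem (by fun_prop)
  simp only [hexp]
  rw [integral_finsetSum _ fun x _ => integrable_finsetSum _ fun y _ => hint _ x y,
    Matrix.trace, ← (trialsEquiv I O n).sum_comp]
  refine Finset.sum_congr rfl fun x _ => ?_
  rw [integral_finsetSum _ fun y _ => hint _ x y, Matrix.diag_apply, Matrix.mul_apply,
    ← (trialsEquiv I O n).sum_comp]
  refine Finset.sum_congr rfl fun y _ => ?_
  rw [integral_const_mul, siteTensor_trialsEquiv, asOneShot_apply, hP.mixture n hn]

end Reduced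

/-! ### Combs on all sites of all trials. -/

section Comb

variable {S : Type*} {I O : S → Type*} [Fintype S] [DecidableEq S]
  [∀ s, Fintype (I s)] [∀ s, Fintype (O s)] [∀ s, DecidableEq (I s)] [∀ s, DecidableEq (O s)]
  [∀ s, Nonempty (O s)]

theorem IsDeFinettiMeasure.ae_noSignalling_of_comb
    {W : ∀ n : ℕ, Matrix (Fin n → Idx I O) (Fin n → Idx I O) ℂ} {P : Measure (Op I O)}
    (hP : IsDeFinettiMeasure W P) {N : ℕ} (hN : 2 ≤ N) {rank : S → ℕ}
    (hrank : Function.Injective rank) {globalRank : Fin N × S → ℕ}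
    (hglobal : Function.Injective globalRank)
    (hmono : ∀ j s t, rank s < rank t → globalRank (j, s) < globalRank (j, t))
    (hcomb : ∀ c, noSignallingMap (before globalRank c) (after globalRank c)
      (asOneShot (W N)) = 0) (c : ℕ) :
    ∀ᵐ w ∂P, noSignallingMap (I := I) (O := O) (before rank c) (after rank c) w = 0 := by
  have := hP.prob
  set K := before rank c with hK
  let D : CPTPPair I O (after rank c) → (∀ s : {s // s ∈ K}, I s × O s) →
      (∀ s : {s // s ∈ K}, I s × O s) → Module.Dual ℂ (Op I O) := fun p x y =>
    (Matrix.entryLinearMap ℂ ℂ x y) ∘ₗ (reduced K p.1.1 - reduced K p.1.2)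
  have hD : ∀ᵐ w ∂P, ∀ g ∈ {g | ∃ p x y, g = D p x y}, g w = 0 := by
    refine ae_forall_eq_zero_of_forall_ae _ ?_
    rintro _ ⟨⟨⟨M, M'⟩, hM, hM', hMM'⟩, x, y, rfl⟩
    dsimp only at hM hM' hMM'
    have hDw : ∀ w, D ⟨(M, M'), hM, hM', hMM'⟩ x y w =
        (siteTensor (unitsOn K y x M) * w).trace - (siteTensor (unitsOn K y x M') * w).trace := by
      intro w
      rw [← reduced_apply_eq_trace, ← reduced_apply_eq_trace]
      rfl
    rcases (after rank c).eq_empty_or_nonempty with hempty | hne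
    · have : M = M' := funext fun s => hMM' s (by simp [hempty])
      subst this
      exact Filter.Eventually.of_forall fun w => by rw [hDw, sub_self]
    -- `t` is the first site from position `c` on. The two trials below are named so that `t` comes
    -- later in trial `j`, and the global cut is placed at `(j, t)`.
    obtain ⟨t, htc, htmin⟩ := Finset.exists_min_image _ rank hne
    have htc' : c ≤ rank t := by simpa [after] using htc
    have htmin' : ∀ s, rank s < rank t → rank s < c := by
      intro s hs
      by_contra! hcs
      exact absurd (htmin s (by simpa [after] using hcs)) (by omega)
    obtain ⟨i, j, hij⟩ : ∃ i j : Fin N, globalRank (i, t) < globalRank (j, t) := by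
      have hne : globalRank (⟨0, by omega⟩, t) ≠ globalRank (⟨1, by omega⟩, t) := by
        intro h
        have := hglobal h
        simp at this
      rcases lt_or_gt_of_ne hne with h | h
      exacts [⟨_, _, h⟩, ⟨_, _, h⟩]
    have hne : i ≠ j := by rintro rfl; exact lt_irrefl _ hij
    -- In trial `j` the global cut restricts exactly to `K`; in trial `i` all of `K`, and possibly
    -- more, lies before it.
    have hj : ∀ s, s ∉ K ↔ (j, s) ∉ before globalRank (globalRank (j, t)) := by
      intro s
      simp only [hK, before, Finset.mem_filter, Finset.mem_univ, true_and, not_lt]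
      constructor
      · intro hs
        by_contra! hlt
        rcases lt_trichotomy (rank s) (rank t) with h | h | h
        · exact absurd (htmin' s h) (by omega)
        · rw [hrank h] at hlt; exact lt_irrefl _ hlt
        · exact absurd (hmono j t s h) (by omega)
      · intro hs
        by_contra! hlt
        exact absurd (hmono j s t (by omega)) (by omega)
    have hi : ∀ s, (i, s) ∉ before globalRank (globalRank (j, t)) → s ∉ K := by
      intro s hs hsK
      simp only [hK, before, Finset.mem_filter, Finset.mem_univ, true_and, not_lt] at hs hsK
      have := hmono i s t (by omega)
      omega
    have hB : ∀ M₂ : LocalOps I O, (∀ s, IsCPTP (M₂ s)) →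
        ∫ w, (siteTensor (unitsOn K y x M) * w).trace *
          (siteTensor (unitsOn K x y M₂) * w).trace ∂P =
        ∫ w, (siteTensor (unitsOn K y x M') * w).trace *
          (siteTensor (unitsOn K x y M₂) * w).trace ∂P := by
      intro M₂ hM₂
      let base : LocalOps I O → LocalOps (fun p : Fin N × S => I p.2) (fun p => O p.2) :=
        fun A p => if p.1 = j then A p.2 else M₂ p.2
      -- Matrix units are inserted only before the cut, where they need not be CPTP. Changing `M` to
      -- `M'` affects trial `j` only after the cut, so no-signalling makes the traces equal.
      let ext : LocalOps I O → LocalOps (fun p : Fin N × S => I p.2) (fun p => O p.2) :=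
        fun A p => if p.1 = j then unitsOn K y x A p.2 else
          if p.1 = i then unitsOn K x y M₂ p.2 else M₂ p.2
      have hbase : ∀ A : LocalOps I O, (∀ s, IsCPTP (A s)) → ∀ p, IsCPTP (base A p) := by
        intro A hA p
        dsimp only [base]
        split_ifs
        exacts [hA _, hM₂ _]
      have hext : ∀ A p, p ∉ before globalRank (globalRank (j, t)) → ext A p = base A p := by
        rintro A ⟨l, s⟩ hp
        dsimp only [base, ext]
        split_ifs with h1 h2
        · subst h1
          exact unitsOn_of_notMem _ _ _ ((hj s).2 hp)
        · subst h2
          exact unitsOn_of_notMem _ _ _ (hi s hp)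
        · rfl
      have htr : ∀ A : LocalOps I O, (siteTensor (ext A) * asOneShot (W N)).trace =
          ∫ w, (siteTensor (unitsOn K y x A) * w).trace *
            (siteTensor (unitsOn K x y M₂) * w).trace ∂P := by
        intro A
        rw [hP.trace_asOneShot (by omega)]
        refine integral_congr_ae ?_
        filter_upwards [hP.process] with w hw
        rw [Fintype.prod_eq_mul j i hne.symm]
        · simp only [ext, if_true, if_neg hne]
        · rintro l ⟨hlj, hli⟩
          simp only [ext, if_neg hlj, if_neg hli]
          exact hw.2 M₂ hM₂
      rw [← htr, ← htr]
      refine trace_eq_of_noSignallingMap_eq_zero (hcomb (globalRank (j, t))) (hbase M hM)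
        (hbase M' hM') ?_ (hext M) (hext M') ?_
      · rintro ⟨l, s⟩ hs
        dsimp only [base]
        split_ifs with h
        · subst h
          refine hMM' s fun hsc => ?_
          have hsK : s ∉ K := by
            simp only [hK, before, after, Finset.mem_filter, Finset.mem_univ, true_and] at hsc ⊢
            omega
          have := (hj s).1 hsK
          simp only [before, after, Finset.mem_filter, Finset.mem_univ, true_and] at hs this
          omega
        · rfl
      · rintro ⟨l, s⟩ hs
        dsimp only [ext]
        split_ifs with h
        · subst h
          have hsK : s ∈ K := by
            by_contra hsK
            exact (hj s).1 hsK hs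
          rw [unitsOn_of_mem _ _ _ hsK, unitsOn_of_mem _ _ _ hsK]
        · rfl
        · rfl
    have hcont : ∀ A : Op I O, Continuous fun w : Op I O => (A * w).trace := fun A => by fun_prop
    have hint : ∀ A B : Op I O, Integrable (fun w => (A * w).trace * (B * w).trace) P :=
      fun A B => integrable_of_continuous smul_one_mem_cptpTensors hP.ae_mem
        ((hcont A).mul (hcont B))
    have hsub : ∀ A B C : Op I O,
        Integrable (fun w => (A * w).trace * (C * w).trace - (B * w).trace * (C * w).trace) P :=
      fun A B C => (hint A C).sub (hint B C)
    refine ae_eq_zero_of_integral_mul_star (integrable_of_continuous smul_one_mem_cptpTensors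
      hP.ae_mem ((continuous_dual _).mul (continuous_dual _).star)) ?_
    -- The squared modulus expands into four products, which cancel in pairs under the integral by
    -- `hB` with `M₂ = M` and `M₂ = M'`.
    have hexp : ∀ᵐ w ∂P, D ⟨(M, M'), hM, hM', hMM'⟩ x y w *
        star (D ⟨(M, M'), hM, hM', hMM'⟩ x y w) =
        ((siteTensor (unitsOn K y x M) * w).trace * (siteTensor (unitsOn K x y M) * w).trace -
        (siteTensor (unitsOn K y x M') * w).trace * (siteTensor (unitsOn K x y M) * w).trace) -
        ((siteTensor (unitsOn K y x M) * w).trace * (siteTensor (unitsOn K x y M') * w).trace -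
        (siteTensor (unitsOn K y x M') * w).trace *
          (siteTensor (unitsOn K x y M') * w).trace) := by
      filter_upwards [hP.process] with w hw
      rw [hDw, star_sub, star_trace_unitsOn K hM hw.1.1, star_trace_unitsOn K hM' hw.1.1]
      ring
    rw [integral_congr_ae hexp, integral_sub (hsub _ _ _) (hsub _ _ _),
      integral_sub (hint _ _) (hint _ _),
      integral_sub (hint _ _) (hint _ _), hB M hM, hB M' hM', sub_self, sub_self, sub_self]
  filter_upwards [hD] with w hw
  ext p x y
  exact hw _ ⟨p, x, y, rfl⟩

end Comb

end ProcessDeFinetti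

end

/-! ### The four cases of the theorem. -/

theorem corollary2 {S : Type*} [Fintype S] [DecidableEq S] {I O : S → Type*}
    [∀ s, Fintype (I s)] [∀ s, Fintype (O s)] [∀ s, DecidableEq (I s)] [∀ s, DecidableEq (O s)]
    [∀ s, Nonempty (I s)] [∀ s, Nonempty (O s)]
    (W : ∀ n : ℕ, Matrix (Fin n → ProcessDeFinetti.Idx I O) (Fin n → ProcessDeFinetti.Idx I O) ℂ)
    (hW : ProcessDeFinetti.IsExchangeable W) (N : ℕ) (hN : 2 ≤ N) :
    -- arbitrary linear constraints in each trial
    (∀ {κ : Type*} {V : κ → Type*} [∀ k, AddCommGroup (V k)] [∀ k, Module ℝ (V k)]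
      (L : ∀ k, selfAdjoint (ProcessDeFinetti.Op I O) →ₗ[ℝ] V k),
      (∀ k j, ProcessDeFinetti.applyAtTrial j (ProcessDeFinetti.complexExtension (L k)) (W N) = 0) →
      ProcessDeFinetti.HasUniqueDeFinetti W
        {w | ∃ hw : w ∈ selfAdjoint (ProcessDeFinetti.Op I O), ∀ k, L k ⟨w, hw⟩ = 0}) ∧
    -- no-signalling constraints in each trial
    (∀ {κ : Type*} (K₁ K₂ : κ → Finset S), (∀ k, Disjoint (K₁ k) (K₂ k)) →
      (∀ k j, ProcessDeFinetti.applyAtTrial j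
        (ProcessDeFinetti.noSignallingMap (I := I) (O := O) (K₁ k) (K₂ k)) (W N) = 0) →
      ProcessDeFinetti.HasUniqueDeFinetti W
        {w | ∀ k, ProcessDeFinetti.noSignallingMap (K₁ k) (K₂ k) w = 0}) ∧
    -- causal order of the sites in each trial
    (∀ rank : S → ℕ, Function.Injective rank →
      (∀ c j, ProcessDeFinetti.applyAtTrial j
        (ProcessDeFinetti.noSignallingMap (I := I) (O := O)
          (ProcessDeFinetti.before rank c) (ProcessDeFinetti.after rank c)) (W N) = 0) →
      ProcessDeFinetti.HasUniqueDeFinetti W {w | ProcessDeFinetti.IsComb rank w}) ∧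
    -- the `N`-trial process is a comb for an order that orders the sites in each trial alike
    (∀ rank : S → ℕ, Function.Injective rank →
      ∀ globalRank : Fin N × S → ℕ, Function.Injective globalRank →
      (∀ j s t, rank s < rank t → globalRank (j, s) < globalRank (j, t)) →
      ProcessDeFinetti.IsComb globalRank (ProcessDeFinetti.asOneShot (W N)) →
      ProcessDeFinetti.HasUniqueDeFinetti W {w | ProcessDeFinetti.IsComb rank w}) := by
  have hcomb : ∀ rank : S → ℕ,
      (∀ P, ProcessDeFinetti.IsDeFinettiMeasure W P → ∀ c, ∀ᵐ w ∂P,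
        ProcessDeFinetti.noSignallingMap (I := I) (O := O) (ProcessDeFinetti.before rank c)
          (ProcessDeFinetti.after rank c) w = 0) →
      ProcessDeFinetti.HasUniqueDeFinetti W {w | ProcessDeFinetti.IsComb rank w} := by
    intro rank h
    refine hW.hasUniqueDeFinetti fun P hP => ?_
    filter_upwards [hP.process, ae_all_iff.2 (h P hP)] with w hw hc using ⟨hw, hc⟩
  refine ⟨?_, ?_, ?_, ?_⟩
  · intro κ V _ _ L hL
    refine hW.hasUniqueDeFinetti fun P hP => ?_
    -- Blocks of `W N` need not be Hermitian, so the common real kernel is complexified. Almost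
    -- every `w` is Hermitian and equals its real part, which returns the real constraint.
    have hT := hP.ae_mem_submodule hN
      (ProcessDeFinetti.complexSpan (⨅ k, LinearMap.ker (L k))) fun j x y => by
        have h : ∀ k, ProcessDeFinetti.complexExtension (L k)
            (ProcessDeFinetti.trialBlock j (W N) x y) = 0 := fun k =>
          congrFun (congrFun (hL k j) x) y
        constructor
        · exact (Submodule.mem_iInf _).2 fun k => congrArg Prod.fst (h k)
        · exact (Submodule.mem_iInf _).2 fun k => congrArg Prod.snd (h k)
    filter_upwards [hP.process, hT] with w hw hwT
    refine ⟨hw.1.1, fun k => ?_⟩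
    have h1 := (Submodule.mem_iInf _).1 hwT.1 k
    rwa [LinearMap.mem_ker, show realPart w = ⟨w, hw.1.1⟩ from
      Subtype.ext (IsSelfAdjoint.coe_realPart hw.1.1)] at h1
  · intro κ K₁ K₂ _ hK
    refine hW.hasUniqueDeFinetti fun P hP => ?_
    have hT := hP.ae_mem_submodule hN (⨅ k, LinearMap.ker
      (ProcessDeFinetti.noSignallingMap (I := I) (O := O) (K₁ k) (K₂ k))) fun j x y =>
        (Submodule.mem_iInf _).2 fun k => congrFun (congrFun (hK k j) x) y
    filter_upwards [hT] with w hw k using (Submodule.mem_iInf _).1 hw k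
  · intro rank _ hc
    exact hcomb rank fun P hP c => hP.ae_mem_submodule hN (LinearMap.ker
      (ProcessDeFinetti.noSignallingMap (I := I) (O := O) (ProcessDeFinetti.before rank c)
        (ProcessDeFinetti.after rank c))) fun j x y => congrFun (congrFun (hc c j) x) y
  · intro rank hrank globalRank hglobal hmono hc
    exact hcomb rank fun P hP c =>
      hP.ae_noSignalling_of_comb hN hrank hglobal hmono hc.2 c
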